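/- Let $n\ge 0$ be an integer and let $\theta=(\theta_{ij})$ be a skew-symmetric complex $n\times n$ matrix; put $q_{ij}=\exp(\tfrac{\mathrm i}{2}\theta_{ij})$. Let $\mathcal A=\mathcal A(\mathbb{CP}^n_\theta)$ be the homogeneous coordinate algebra of $\mathbb{CP}^n_\theta$, i.e. the unital associative $\mathbb C$-algebra generated by $w_1,\dots,w_{n+1}$ with the relations $w_{n+1}w_i=w_iw_{n+1}$ for $1\le i\le n$ and $w_iw_j=q_{ij}^2\,w_jw_i$ for $1\le i,j\le n$, graded by polynomial degree: $\mathcal A_k$ is the linear span of the products of $k$ generators. Then $\mathcal A$ is an Artin–Schelter regular algebra of dimension $d=n+1$, that is: 1. $\mathcal A=\bigoplus_{k\ge0}\mathcal A_k$ is a connected graded algebra ($\mathcal A_0=\mathbb C$) with all $\mathcal A_k$ finite-dimensional; 2. the global homological dimension of $\mathcal A$ (the supremum of the projective dimensions of all right $\mathcal A$-modules) is $n+1$; 3. the Gel'fand–Kirillov dimension of $\mathcal A$ is finite; 4. (Gorenstein property) $\mathrm{Ext}^k(\mathcal A_0,\mathcal A)=0$ for $k\ne n+1$, and $\mathrm{Ext}^{n+1}(\mathcal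 A_0,\mathcal A)\cong\mathcal A_0=\mathbb C$ as left $\mathcal A$-modules. Here $\mathrm{Ext}$ is taken in the category of right $\mathcal A$-modules, and $\mathcal A_0=\mathcal A/\bigoplus_{k\ge1}\mathcal A_k$ is the trivial (right, respectively left) module. Moreover the Gel'fand–Kirillov dimension is $$\mathrm{GK\text{-}dim}(\mathcal A):=\inf\Big\{\alpha\in\mathbb R\;\Big|\;\dim_{\mathbb C}\Big(\bigoplus_{l=0}^k\mathcal A_l\Big)\le k^\alpha\text{ for all sufficiently large }k\Big\}=n+1.$$ -/

import Mathlib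

open CategoryTheory CategoryTheory.Abelian Filter

universe u

noncomputable section

section Graded

variable {A : Type u} [Ring A] [Algebra ℂ A]

/-- `A = ⨁ₖ 𝒜 k` is a connected (`𝒜 0 = ℂ`) locally finite `ℕ`-graded complex algebra. -/
structure IsConnectedGraded (𝒜 : ℕ → Submodule ℂ A) : Prop where
  gradedMonoid : SetLike.GradedMonoid 𝒜
  isInternal : DirectSum.IsInternal 𝒜
  finiteDimensional : ∀ k, FiniteDimensional ℂ (𝒜 k)
  connected : Module.finrank ℂ (𝒜 0) = 1

/-- The right ideal of `A` generated by the elements of positive degree. -/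
def rightAugmentationIdeal (𝒜 : ℕ → Submodule ℂ A) : Submodule Aᵐᵒᵖ A :=
  Submodule.span Aᵐᵒᵖ (⋃ k ∈ Set.Ici 1, (𝒜 k : Set A))

/-- The left ideal of `A` generated by the elements of positive degree. -/
def leftAugmentationIdeal (𝒜 : ℕ → Submodule ℂ A) : Submodule A A :=
  Submodule.span A (⋃ k ∈ Set.Ici 1, (𝒜 k : Set A))

/-- The trivial right module `A₀ = A / A₊`. Right `A`-modules are modules over `Aᵐᵒᵖ`. -/
abbrev trivialRightModule (𝒜 : ℕ → Submodule ℂ A) : ModuleCat.{u} Aᵐᵒᵖ :=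
  ModuleCat.of Aᵐᵒᵖ (A ⧸ rightAugmentationIdeal 𝒜)

/-- The trivial left module `A₀ = A / A₊`. -/
abbrev TrivialLeftModule (𝒜 : ℕ → Submodule ℂ A) : Type u :=
  A ⧸ leftAugmentationIdeal 𝒜

variable (A) in
/-- The algebra `A` as a right module over itself. -/
abbrev regularRightModule : ModuleCat.{u} Aᵐᵒᵖ := ModuleCat.of Aᵐᵒᵖ A

/-- Left multiplication by `a`, an endomorphism of the right module `A`. -/
def leftMulHom (a : A) : regularRightModule A ⟶ regularRightModule A :=
  ModuleCat.ofHom (Module.toModuleEnd Aᵐᵒᵖ A a)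

/-- The left `A`-module structure on `Ext^k(X, A)` (`X` a right module) induced by left
multiplication on the second argument. -/
instance extLeftModule (X : ModuleCat.{u} Aᵐᵒᵖ) (k : ℕ) :
    Module A (Ext.{u} X (regularRightModule A) k) where
  smul a e := e.comp (Ext.mk₀ (leftMulHom a)) (add_zero k)
  one_smul e := by
    change e.comp (Ext.mk₀ (leftMulHom 1)) (add_zero k) = e
    have h : leftMulHom (1 : A) = 𝟙 _ := by
      simp only [leftMulHom, map_one]; rfl
    rw [h, Ext.comp_mk₀_id]
  mul_smul a b e := by
    change e.comp (Ext.mk₀ (leftMulHom (a * b))) (add_zero k) =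
      (e.comp (Ext.mk₀ (leftMulHom b)) (add_zero k)).comp (Ext.mk₀ (leftMulHom a)) (add_zero k)
    have h : leftMulHom (a * b) = leftMulHom b ≫ leftMulHom a := by
      simp only [leftMulHom, map_mul]; rfl
    rw [h, ← Ext.mk₀_comp_mk₀, Ext.comp_assoc_of_third_deg_zero]
  smul_zero a := Ext.zero_comp X k (Ext.mk₀ (leftMulHom a)) k (add_zero k)
  smul_add a e f := Ext.add_comp _ _ _ (add_zero k)
  add_smul a b e := by
    change e.comp (Ext.mk₀ (leftMulHom (a + b))) (add_zero k) =
      e.comp (Ext.mk₀ (leftMulHom a)) (add_zero k) + e.comp (Ext.mk₀ (leftMulHom b)) (add_zero k)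
    have h : leftMulHom (a + b) = leftMulHom a + leftMulHom b := by
      simp only [leftMulHom, map_add]; rfl
    rw [h, Ext.mk₀_add, Ext.comp_add]
  zero_smul e := by
    change e.comp (Ext.mk₀ (leftMulHom 0)) (add_zero k) = 0
    have h : leftMulHom (0 : A) = 0 := by
      simp only [leftMulHom, map_zero]; rfl
    rw [h, Ext.mk₀_zero, Ext.comp_zero]

variable (A) in
/-- The (right) global homological dimension of `A`: the supremum of the projective dimensions
of all right `A`-modules. -/
def rightGlobalDimension : WithBot ℕ∞ :=
  ⨆ M : ModuleCat.{u} Aᵐᵒᵖ, projectiveDimension M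

/-- The Gel'fand–Kirillov dimension: the infimum of all real `α` such that
`dim (⨁_{l ≤ k} 𝒜 l) ≤ k ^ α` for all large `k` (and `⊤` if there is no such `α`). -/
def gkDim (𝒜 : ℕ → Submodule ℂ A) : EReal :=
  sInf {x : EReal | ∃ α : ℝ, x = (α : EReal) ∧ ∀ᶠ k : ℕ in atTop,
    FiniteDimensional ℂ (⨆ l ≤ k, 𝒜 l : Submodule ℂ A) ∧
      (Module.finrank ℂ (⨆ l ≤ k, 𝒜 l : Submodule ℂ A) : ℝ) ≤ (k : ℝ) ^ α}

/-- Artin–Schelter regularity of dimension `d`: a connected graded algebra of finite global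
dimension `d`, of finite Gel'fand–Kirillov dimension, with the Gorenstein property
`Ext^k(A₀, A) = 0` for `k ≠ d` and `Ext^d(A₀, A) ≅ A₀ = ℂ` as left `A`-modules, the `Ext` groups
being taken in the category of right `A`-modules. -/
structure IsArtinSchelterRegular (𝒜 : ℕ → Submodule ℂ A) (d : ℕ) : Prop where
  connectedGraded : IsConnectedGraded 𝒜
  globalDimension : rightGlobalDimension A = (d : WithBot ℕ∞)
  gkDim_lt_top : gkDim 𝒜 < ⊤
  ext_eq_zero : ∀ k : ℕ, k ≠ d →
    Subsingleton (Ext.{u} (trivialRightModule 𝒜) (regularRightModule A) k)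
  ext_top : Nonempty
    (Ext.{u} (trivialRightModule 𝒜) (regularRightModule A) d ≃ₗ[A] TrivialLeftModule 𝒜)

end Graded

section ProjectiveSpace

variable {n : ℕ}

/-- The deformation parameters `q_{ij} = exp((i/2) θ_{ij})`. -/
def qParam (θ : Matrix (Fin n) (Fin n) ℂ) (i j : Fin n) : ℂ :=
  Complex.exp (Complex.I / 2 * θ i j)

/-- The quadratic relations of the homogeneous coordinate algebra; the generator `w_{n+1}` has the
index `Fin.last n`, and `w_1, …, w_n` have the indices `Fin.castSucc i`. -/
inductive HomCoordRel (θ : Matrix (Fin n) (Fin n) ℂ) :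
    FreeAlgebra ℂ (Fin (n + 1)) → FreeAlgebra ℂ (Fin (n + 1)) → Prop
  | last_mul (i : Fin n) : HomCoordRel θ
      (FreeAlgebra.ι ℂ (Fin.last n) * FreeAlgebra.ι ℂ i.castSucc)
      (FreeAlgebra.ι ℂ i.castSucc * FreeAlgebra.ι ℂ (Fin.last n))
  | mul_mul (i j : Fin n) : HomCoordRel θ
      (FreeAlgebra.ι ℂ i.castSucc * FreeAlgebra.ι ℂ j.castSucc)
      (qParam θ i j ^ 2 • (FreeAlgebra.ι ℂ j.castSucc * FreeAlgebra.ι ℂ i.castSucc))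

/-- The homogeneous coordinate algebra of the noncommutative projective space. -/
abbrev HomCoordAlg (θ : Matrix (Fin n) (Fin n) ℂ) : Type := RingQuot (HomCoordRel θ)

/-- The generators `w_1, …, w_{n+1}`. -/
def homCoordGen (θ : Matrix (Fin n) (Fin n) ℂ) (i : Fin (n + 1)) : HomCoordAlg θ :=
  RingQuot.mkAlgHom ℂ (HomCoordRel θ) (FreeAlgebra.ι ℂ i)

/-- The grading by polynomial degree: the degree `k` part is the linear span of all products of
`k` generators. -/
def homCoordGrading (θ : Matrix (Fin n) (Fin n) ℂ) (k : ℕ) : Submodule ℂ (HomCoordAlg θ) :=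
  (Submodule.span ℂ (Set.range (homCoordGen θ))) ^ k

end ProjectiveSpace

end

/-! Any two generators commute up to a nonzero scalar, and skew-symmetry of `θ` gives `p i j * p j i
= 1` and `p i i = 1`. The algebra is therefore a quantum affine space in `N = n + 1` variables and
behaves homologically like a polynomial ring.

Monomials with fixed orderings of their factors form a basis. They span by reordering; they are
independent because the left regular representation can be written down on formal sorted monomials
(`linearIndependent_monomialOf`). The grading is then read off the basis, and the growth is a count
of multisets, of order `k ^ N`.

For the upper bound on global dimension, let `M` be a module and `x j` a generator. A twisted form
of the sequence `0 → M[t] → M[t] → M → 0`, with first map `t - x j` and second map `t ↦ x j`,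
resolves `M` by modules that are free in the direction `j`. Repeating this in each direction ends at
free modules, so the projective dimension is at most `N` (`hasProjectiveDimensionLE`). Right modules
are covered because the opposite algebra is again a quantum affine space.

For the Gorenstein property, left multiplication by `x l` is injective on `R / (x j, j ∈ J)` when `l
∉ J`, with cokernel `R / (x j, j ∈ J ∪ {l})`. The long exact Ext sequence moves the only nonzero
group `Ext(-, R)` up by one degree (`IsGorensteinAt.insert`). The induction must also carry how the
remaining generators act on that group. Taking all generators gives Ext of the trivial module, and
its nonvanishing in degree `N` gives the lower bound on global dimension. -/

/-- The algebra `R` is the quantum affine space with generators `x i` and relations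
`x i * x j = p i j • (x j * x i)`. -/
structure IsQuantumAffine {N : ℕ} {R : Type} [Ring R] [Algebra ℂ R]
    (p : Fin N → Fin N → ℂ) (x : Fin N → R) : Prop where
  param_mul : ∀ i j, p i j * p j i = 1
  param_self : ∀ i, p i i = 1
  comm : ∀ i j, x i * x j = p i j • (x j * x i)
  adjoin : Algebra.adjoin ℂ (Set.range x) = ⊤
  lift : ∀ (B : Type) [Ring B] [Algebra ℂ B] (y : Fin N → B),
    (∀ i j, y i * y j = p i j • (y j * y i)) → ∃ f : R →ₐ[ℂ] B, ∀ i, f (x i) = y i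

/-! ### Opposite algebra and reordering of words -/

namespace IsQuantumAffine

variable {N : ℕ} {R : Type} [Ring R] [Algebra ℂ R] {p : Fin N → Fin N → ℂ} {x : Fin N → R}

theorem param_ne_zero (h : IsQuantumAffine p x) (i j : Fin N) : p i j ≠ 0 :=
  left_ne_zero_of_mul_eq_one (h.param_mul i j)

/-- The opposite of a quantum affine space is a quantum affine space. -/
theorem op (h : IsQuantumAffine p x) :
    IsQuantumAffine (fun i j => p j i) (fun i => MulOpposite.op (x i)) where
  param_mul i j := h.param_mul j i
  param_self := h.param_self
  comm i j := by
    rw [← MulOpposite.op_mul, ← MulOpposite.op_mul, ← MulOpposite.op_smul, h.comm j i]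
  adjoin := by
    have h2 := congrArg Subalgebra.op h.adjoin
    rw [Subalgebra.op_adjoin, Subalgebra.op_top] at h2
    rw [← h2]
    congr 1
    ext y
    simp only [Set.mem_range, Set.mem_preimage]
    constructor
    · rintro ⟨i, rfl⟩
      exact ⟨i, rfl⟩
    · rintro ⟨i, hi⟩
      exact ⟨i, by rw [hi, MulOpposite.op_unop]⟩
  lift B _ _ y hy := by
    obtain ⟨f, hf⟩ := h.lift Bᵐᵒᵖ (fun i => MulOpposite.op (y i)) fun i j => by
      rw [← MulOpposite.op_mul, ← MulOpposite.op_mul, ← MulOpposite.op_smul, hy j i]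
    exact ⟨AlgHom.opComm f, fun i => by simp [AlgHom.opComm, hf]⟩

theorem exists_smul_of_perm (h : IsQuantumAffine p x) {l₁ l₂ : List (Fin N)} (hl : l₁.Perm l₂) :
    ∃ c : ℂ, c ≠ 0 ∧ (l₁.map x).prod = c • (l₂.map x).prod := by
  induction hl with
  | nil => exact ⟨1, one_ne_zero, by simp⟩
  | cons a _ ih =>
    obtain ⟨c, hc, e⟩ := ih
    exact ⟨c, hc, by simp [e]⟩
  | swap a b l =>
    refine ⟨p b a, h.param_ne_zero b a, ?_⟩
    simp only [List.map_cons, List.prod_cons, ← mul_assoc]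
    rw [h.comm b a, smul_mul_assoc]
  | trans _ _ ih₁ ih₂ =>
    obtain ⟨c, hc, e⟩ := ih₁
    obtain ⟨d, hd, e'⟩ := ih₂
    exact ⟨c * d, mul_ne_zero hc hd, by rw [e, e', smul_smul]⟩

end IsQuantumAffine

/-! ### The monomial basis -/

/-- The monomial in the `x i` with multiset of indices `s`, up to the order of the factors. -/
noncomputable def monomialOf {N : ℕ} {R : Type} [Ring R] (x : Fin N → R)
    (s : Multiset (Fin N)) : R :=
  (s.toList.map x).prod

@[simp]
theorem monomialOf_zero {N : ℕ} {R : Type} [Ring R] (x : Fin N → R) : monomialOf x 0 = 1 := by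
  simp [monomialOf]

@[simp]
theorem monomialOf_singleton {N : ℕ} {R : Type} [Ring R] (x : Fin N → R) (i : Fin N) :
    monomialOf x {i} = x i := by
  simp [monomialOf]

namespace IsQuantumAffine

variable {N : ℕ} {R : Type} [Ring R] [Algebra ℂ R] {p : Fin N → Fin N → ℂ} {x : Fin N → R}

theorem exists_list_prod_eq (h : IsQuantumAffine p x) (l : List (Fin N)) :
    ∃ c : ℂ, c ≠ 0 ∧ (l.map x).prod = c • monomialOf x (l : Multiset (Fin N)) :=
  h.exists_smul_of_perm (Multiset.coe_eq_coe.1 (Multiset.coe_toList _).symm)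

theorem exists_monomialOf_mul (h : IsQuantumAffine p x) (s t : Multiset (Fin N)) :
    ∃ c : ℂ, c ≠ 0 ∧ monomialOf x s * monomialOf x t = c • monomialOf x (s + t) := by
  obtain ⟨c, hc, e⟩ := h.exists_list_prod_eq (s.toList ++ t.toList)
  refine ⟨c, hc, ?_⟩
  rw [List.map_append, List.prod_append, ← Multiset.coe_add, Multiset.coe_toList,
    Multiset.coe_toList] at e
  exact e

theorem exists_mul_monomialOf (h : IsQuantumAffine p x) (i : Fin N) (s : Multiset (Fin N)) :
    ∃ c : ℂ, c ≠ 0 ∧ x i * monomialOf x s = c • monomialOf x (i ::ₘ s) := by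
  simpa using h.exists_monomialOf_mul {i} s

theorem exists_monomialOf_mul_gen (h : IsQuantumAffine p x) (i : Fin N)
    (s : Multiset (Fin N)) :
    ∃ c : ℂ, c ≠ 0 ∧ monomialOf x s * x i = c • monomialOf x (i ::ₘ s) := by
  simpa [add_comm s, Multiset.singleton_add] using
    h.exists_monomialOf_mul s {i}

theorem span_monomialOf (h : IsQuantumAffine p x) :
    Submodule.span ℂ (Set.range (monomialOf x)) = ⊤ := by
  set S := Submodule.span ℂ (Set.range (monomialOf x)) with hS
  rw [eq_top_iff]
  intro r hr
  replace hr : r ∈ Algebra.adjoin ℂ (Set.range x) := h.adjoin ▸ Algebra.mem_top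
  -- The elements multiplying `S` into itself form a subalgebra, so only generators need checking;
  -- `m = 1` recovers `r`.
  suffices ∀ m ∈ S, r * m ∈ S by
    have h1 : (1 : R) ∈ S := Submodule.subset_span ⟨0, by simp⟩
    simpa using this 1 h1
  induction hr using Algebra.adjoin_induction with
  | mem r hr =>
    obtain ⟨i, rfl⟩ := hr
    intro m hm
    induction hm using Submodule.span_induction with
    | mem m hm =>
      obtain ⟨s, rfl⟩ := hm
      obtain ⟨c, -, e⟩ := h.exists_mul_monomialOf i s
      rw [e]
      exact S.smul_mem _ (Submodule.subset_span ⟨_, rfl⟩)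
    | zero => simp
    | add a b _ _ ha hb => rw [mul_add]; exact S.add_mem ha hb
    | smul c a _ ha => rw [mul_smul_comm]; exact S.smul_mem _ ha
  | algebraMap c =>
    intro m hm
    rw [← Algebra.smul_def]
    exact S.smul_mem _ hm
  | add a b _ _ ha hb =>
    intro m hm
    rw [add_mul]
    exact S.add_mem (ha m hm) (hb m hm)
  | mul a b _ _ ha hb =>
    intro m hm
    rw [mul_assoc]
    exact ha _ (hb m hm)

end IsQuantumAffine

/-- The structure constants of the left regular representation in the basis of ordered
monomials. -/
noncomputable def sortCoeff {N : ℕ} (p : Fin N → Fin N → ℂ) (i : Fin N)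
    (s : Multiset (Fin N)) : ℂ :=
  (s.map fun j => if j < i then p i j else 1).prod

/-- The action of the generator `i` on the span of the ordered monomials. -/
noncomputable def sortOp {N : ℕ} (p : Fin N → Fin N → ℂ) (i : Fin N) :
    Module.End ℂ (Multiset (Fin N) →₀ ℂ) :=
  Finsupp.linearCombination ℂ fun s => Finsupp.single (i ::ₘ s) (sortCoeff p i s)

theorem sortOp_single {N : ℕ} (p : Fin N → Fin N → ℂ) (i : Fin N) (s : Multiset (Fin N))
    (a : ℂ) :
    sortOp p i (Finsupp.single s a) = Finsupp.single (i ::ₘ s) (a * sortCoeff p i s) := by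
  simp [sortOp, Finsupp.linearCombination_single]

namespace IsQuantumAffine

variable {N : ℕ} {R : Type} [Ring R] [Algebra ℂ R] {p : Fin N → Fin N → ℂ} {x : Fin N → R}

theorem sortCoeff_ne_zero (h : IsQuantumAffine p x) (i : Fin N) (s : Multiset (Fin N)) :
    sortCoeff p i s ≠ 0 := by
  refine Multiset.prod_ne_zero fun h0 => ?_
  obtain ⟨j, -, hj⟩ := Multiset.mem_map.1 h0
  split_ifs at hj
  · exact h.param_ne_zero _ _ hj
  · exact one_ne_zero hj

/-- The two orders differ only in the factor for moving `i` and `j` past each other. It occurs in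
exactly one of the two orders when `i ≠ j`, and `p i j * p j i = 1` reconciles both cases. -/
theorem sortOp_comm (h : IsQuantumAffine p x) (i j : Fin N) :
    sortOp p i * sortOp p j = p i j • (sortOp p j * sortOp p i) := by
  refine Finsupp.lhom_ext fun s a => ?_
  simp only [Module.End.mul_apply, LinearMap.smul_apply, sortOp_single, Finsupp.smul_single,
    smul_eq_mul]
  rw [Multiset.cons_swap]
  congr 1
  have hc : ∀ a b, sortCoeff p a (b ::ₘ s) = (if b < a then p a b else 1) * sortCoeff p a s := by
    intro a b
    simp [sortCoeff]
  rw [hc, hc]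
  rcases lt_trichotomy i j with hij | rfl | hij
  · rw [if_neg hij.not_gt, if_pos hij]
    linear_combination (-a * sortCoeff p i s * sortCoeff p j s) * h.param_mul i j
  · rw [h.param_self]
    ring
  · rw [if_pos hij, if_neg hij.not_gt]
    ring

/-- Acting on the vector of the empty multiset, the monomial of `s` gives a nonzero multiple of the
basis vector of `s`, so a dependence would already hold among basis vectors. -/
theorem linearIndependent_monomialOf (h : IsQuantumAffine p x) :
    LinearIndependent ℂ (monomialOf x) := by
  obtain ⟨f, hf⟩ := h.lift (Module.End ℂ (Multiset (Fin N) →₀ ℂ)) (sortOp p) h.sortOp_comm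
  have key : ∀ l : List (Fin N), ∃ c : ℂ, c ≠ 0 ∧
      f (l.map x).prod (Finsupp.single 0 1) = Finsupp.single (l : Multiset (Fin N)) c := by
    intro l
    induction l with
    | nil => exact ⟨1, one_ne_zero, by simp⟩
    | cons i l ih =>
      obtain ⟨c, hc, e⟩ := ih
      refine ⟨c * sortCoeff p i l, mul_ne_zero hc (h.sortCoeff_ne_zero i l), ?_⟩
      rw [List.map_cons, List.prod_cons, map_mul, Module.End.mul_apply, e, hf, sortOp_single]
      rfl
  choose c hc e using fun s : Multiset (Fin N) => key s.toList
  let g : R →ₗ[ℂ] (Multiset (Fin N) →₀ ℂ) :=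
    (LinearMap.applyₗ (Finsupp.single 0 1)).comp f.toLinearMap
  refine LinearIndependent.of_comp g ?_
  have hg : g ∘ monomialOf x =
      (fun s => Units.mk0 (c s) (hc s)) • fun s => Finsupp.single s (1 : ℂ) := by
    funext s
    have := e s
    rw [Multiset.coe_toList] at this
    simpa [g, monomialOf, Units.smul_def] using this
  rw [hg]
  exact (Finsupp.linearIndependent_single_one ℂ _).units_smul _

/-- The basis of monomials of a quantum affine space. -/
noncomputable def basis (h : IsQuantumAffine p x) : Module.Basis (Multiset (Fin N)) ℂ R :=
  Module.Basis.mk h.linearIndependent_monomialOf h.span_monomialOf.ge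

@[simp]
theorem basis_apply (h : IsQuantumAffine p x) (s : Multiset (Fin N)) :
    h.basis s = monomialOf x s :=
  Module.Basis.mk_apply _ _ _

end IsQuantumAffine

/-! ### Induced modules and the two-term resolution -/

/-- The vector space `E` as a module over `R` through a representation of `R` on `E`. -/
def RepModule {R E : Type} [Ring R] [Algebra ℂ R] [AddCommGroup E] [Module ℂ E]
    (_ : R →ₐ[ℂ] Module.End ℂ E) : Type := E

namespace RepModule

variable {R E : Type} [Ring R] [Algebra ℂ R] [AddCommGroup E] [Module ℂ E]
  (f : R →ₐ[ℂ] Module.End ℂ E)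

instance : AddCommGroup (RepModule f) := inferInstanceAs (AddCommGroup E)

instance : Module ℂ (RepModule f) := inferInstanceAs (Module ℂ E)

instance : Module R (RepModule f) := Module.compHom E f.toRingHom

/-- The identity map of the underlying vector space. -/
def of : E ≃ₗ[ℂ] RepModule f := LinearEquiv.refl ℂ E

theorem smul_of (r : R) (e : E) : r • of f e = of f (f r e) := rfl

instance : IsScalarTower ℂ R (RepModule f) :=
  ⟨fun c r e => by
    obtain ⟨e, rfl⟩ := (of f).surjective e
    rw [smul_of, smul_of, map_smul, LinearMap.smul_apply, map_smul]⟩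

end RepModule

/-- The action of the generator `i` on the module induced in the direction `j`: the generator `j`
is the shift, the others act on the coefficients, twisted by powers of the parameters. -/
noncomputable def inducedOp {N : ℕ} {R M : Type} [Ring R] [Algebra ℂ R] [AddCommGroup M]
    [Module ℂ M] [Module R M] [IsScalarTower ℂ R M]
    (p : Fin N → Fin N → ℂ) (x : Fin N → R) (j : Fin N) (e : ℕ) (i : Fin N) :
    Module.End ℂ (ℕ →₀ M) :=
  Finsupp.lsum ℂ fun k => if i = j then Finsupp.lsingle (k + 1) else
    (p i j ^ (k + e)) • (Finsupp.lsingle k).comp (Algebra.lsmul ℂ ℂ M (x i))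

section

variable {N : ℕ} {R M : Type} [Ring R] [Algebra ℂ R] [AddCommGroup M]
  [Module ℂ M] [Module R M] [IsScalarTower ℂ R M] {p : Fin N → Fin N → ℂ} {x : Fin N → R}

theorem inducedOp_self (j : Fin N) (e k : ℕ) (m : M) :
    inducedOp p x j e j (Finsupp.single k m) = Finsupp.single (k + 1) m := by
  simp [inducedOp]

theorem inducedOp_of_ne {i j : Fin N} (hij : i ≠ j) (e k : ℕ) (m : M) :
    inducedOp p x j e i (Finsupp.single k m) =
      Finsupp.single k (p i j ^ (k + e) • x i • m) := by
  simp [inducedOp, hij]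

/-- Component `k` plays the role of `x j ^ k ⊗ M`. Shifting it raises the twist by one factor `p i
j`, which is the relation between `x i` and `x j`; this works for every offset `e`. -/
theorem IsQuantumAffine.inducedOp_comm (h : IsQuantumAffine p x) (j : Fin N) (e : ℕ)
    (i k : Fin N) :
    inducedOp (M := M) p x j e i * inducedOp p x j e k =
      p i k • (inducedOp p x j e k * inducedOp p x j e i) := by
  refine Finsupp.lhom_ext fun a m => ?_
  simp only [Module.End.mul_apply, LinearMap.smul_apply]
  by_cases hi : i = j <;> by_cases hk : k = j
  · subst hi hk
    rw [h.param_self, one_smul]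
  · subst hi
    rw [inducedOp_of_ne hk, inducedOp_self, inducedOp_self, inducedOp_of_ne hk,
      Finsupp.smul_single, smul_smul]
    congr 2
    linear_combination (-p k i ^ (a + e)) * h.param_mul i k
  · subst hk
    rw [inducedOp_self, inducedOp_of_ne hi, inducedOp_of_ne hi, inducedOp_self,
      Finsupp.smul_single, smul_smul]
    congr 2
    ring
  · rw [inducedOp_of_ne hi, inducedOp_of_ne hk, inducedOp_of_ne hi, inducedOp_of_ne hk,
      Finsupp.smul_single]
    congr 1
    rw [smul_comm (x i), smul_comm (x k), smul_smul (x i), h.comm i k]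
    simp only [smul_smul, smul_assoc]
    congr 1
    ring

variable (M) in
/-- The representation of a quantum affine space on the module induced in the direction `j`. -/
noncomputable def IsQuantumAffine.inducedRep (h : IsQuantumAffine p x) (j : Fin N) (e : ℕ) :
    R →ₐ[ℂ] Module.End ℂ (ℕ →₀ M) :=
  (h.lift _ (inducedOp p x j e) (h.inducedOp_comm j e)).choose

theorem IsQuantumAffine.inducedRep_gen (h : IsQuantumAffine p x) (j : Fin N) (e : ℕ)
    (i : Fin N) : h.inducedRep M j e (x i) = inducedOp p x j e i :=
  (h.lift _ (inducedOp p x j e) (h.inducedOp_comm j e)).choose_spec i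

/-- A linear map between modules over a quantum affine space which commutes with the generators is
linear over the quantum affine space. -/
theorem IsQuantumAffine.map_smul_of_gen {M' : Type} [AddCommGroup M'] [Module ℂ M'] [Module R M']
    [IsScalarTower ℂ R M'] (h : IsQuantumAffine p x) (f : M →ₗ[ℂ] M')
    (hf : ∀ i m, f (x i • m) = x i • f m) (r : R) (m : M) : f (r • m) = r • f m := by
  have hr : r ∈ Algebra.adjoin ℂ (Set.range x) := h.adjoin ▸ Algebra.mem_top
  induction hr using Algebra.adjoin_induction generalizing m with
  | mem r hr =>
    obtain ⟨i, rfl⟩ := hr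
    exact hf i m
  | algebraMap c => simp
  | add a b _ _ ha hb => rw [add_smul, map_add, ha, hb, add_smul]
  | mul a b _ _ ha hb => rw [mul_smul, ha, hb, mul_smul]

/-- The projection from the module induced in the direction `j`. -/
noncomputable def inducedProj (M : Type) [AddCommGroup M] [Module ℂ M] [Module R M]
    [IsScalarTower ℂ R M] (x : Fin N → R) (j : Fin N) : (ℕ →₀ M) →ₗ[ℂ] M :=
  Finsupp.lsum ℂ fun k => Algebra.lsmul ℂ ℂ M (x j ^ k)

theorem inducedProj_single (j : Fin N) (k : ℕ) (m : M) :
    inducedProj M x j (Finsupp.single k m) = x j ^ k • m := by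
  simp [inducedProj, -map_pow]

/-- The kernel inclusion of the projection from the module induced in the direction `j`. -/
noncomputable def inducedIncl (M : Type) [AddCommGroup M] [Module ℂ M] [Module R M]
    [IsScalarTower ℂ R M] (x : Fin N → R) (j : Fin N) : (ℕ →₀ M) →ₗ[ℂ] (ℕ →₀ M) :=
  Finsupp.lsum ℂ fun k =>
    Finsupp.lsingle (k + 1) - (Finsupp.lsingle k).comp (Algebra.lsmul ℂ ℂ M (x j))

theorem inducedIncl_single (j : Fin N) (k : ℕ) (m : M) :
    inducedIncl M x j (Finsupp.single k m) =
      Finsupp.single (k + 1) m - Finsupp.single k (x j • m) := by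
  simp [inducedIncl]

theorem inducedIncl_apply_succ (j : Fin N) (f : ℕ →₀ M) (k : ℕ) :
    inducedIncl M x j f (k + 1) = f k - x j • f (k + 1) := by
  induction f using Finsupp.induction_linear with
  | zero => simp
  | add f g hf hg =>
    rw [map_add (inducedIncl M x j), Finsupp.add_apply, hf, hg, Finsupp.add_apply, Finsupp.add_apply, smul_add]
    abel
  | single a m =>
    rw [inducedIncl_single]
    simp only [Finsupp.sub_apply, Finsupp.single_apply, add_left_inj]
    split_ifs <;> simp

/-- In the kernel `f k = x j • f (k + 1)`, so a nonzero component forces all later ones to be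
nonzero, against finite support. -/
theorem inducedIncl_injective (j : Fin N) : Function.Injective (inducedIncl M x j) := by
  rw [injective_iff_map_eq_zero]
  intro f hf
  have hs : ∀ k, f k = x j • f (k + 1) := fun k => by
    have := inducedIncl_apply_succ (x := x) j f k
    rw [hf, Finsupp.zero_apply] at this
    exact (sub_eq_zero.1 this.symm)
  obtain ⟨n, hn⟩ : ∃ n, ∀ k, n ≤ k → f k = 0 := by
    refine ⟨f.support.sup id + 1, fun k hk => ?_⟩
    by_contra hne
    have := Finset.le_sup (f := id) (Finsupp.mem_support_iff.2 hne)
    simp only [id] at this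
    omega
  ext k
  by_contra hne
  have : ∀ d, f (k + d) ≠ 0 := by
    intro d
    induction d with
    | zero => exact hne
    | succ d ih =>
      intro h0
      apply ih
      rw [hs (k + d), add_assoc, h0, smul_zero]
  exact this n (hn _ (by omega))

/-- Modulo the image, `single (k + 1) m` equals `single k (x j • m)`. Descending to index `0` makes
every `f` congruent to `single 0` of its projection. -/
theorem inducedIncl_exact (j : Fin N) :
    Function.Exact (inducedIncl M x j) (inducedProj M x j) := by
  have hz : (inducedProj M x j).comp (inducedIncl M x j) = 0 := by
    refine Finsupp.lhom_ext fun k m => ?_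
    simp [inducedIncl_single, inducedProj_single, pow_succ, mul_smul]
  have hr : ∀ f : ℕ →₀ M, ∃ g, f - Finsupp.single 0 (inducedProj M x j f) =
      inducedIncl M x j g := by
    intro f
    induction f using Finsupp.induction_linear with
    | zero => exact ⟨0, by simp⟩
    | add f g hf hg =>
      obtain ⟨a, ha⟩ := hf
      obtain ⟨b, hb⟩ := hg
      refine ⟨a + b, ?_⟩
      rw [map_add, map_add, ← ha, ← hb, Finsupp.single_add]
      abel
    | single k m =>
      induction k generalizing m with
      | zero => exact ⟨0, by simp [inducedProj_single]⟩
      | succ k ih =>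
        obtain ⟨g, hg⟩ := ih (x j • m)
        refine ⟨Finsupp.single k m + g, ?_⟩
        rw [map_add, inducedIncl_single, ← hg, inducedProj_single, inducedProj_single, pow_succ,
          mul_smul]
        abel
  intro f
  constructor
  · intro hf
    obtain ⟨g, hg⟩ := hr f
    rw [hf, Finsupp.single_zero, sub_zero] at hg
    exact ⟨g, hg.symm⟩
  · rintro ⟨g, rfl⟩
    exact LinearMap.congr_fun hz g

theorem inducedProj_surjective (j : Fin N) : Function.Surjective (inducedProj M x j) :=
  fun m => ⟨Finsupp.single 0 m, by simp [inducedProj_single]⟩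

theorem IsQuantumAffine.gen_mul_pow (h : IsQuantumAffine p x) (i j : Fin N) (k : ℕ) :
    x i * x j ^ k = p i j ^ k • (x j ^ k * x i) := by
  induction k with
  | zero => simp
  | succ k ih =>
    rw [pow_succ, ← mul_assoc, ih, smul_mul_assoc, mul_assoc, h.comm i j, mul_smul_comm, smul_smul,
      ← mul_assoc, ← pow_succ]

theorem IsQuantumAffine.inducedProj_inducedOp (h : IsQuantumAffine p x) (i j : Fin N)
    (f : ℕ →₀ M) :
    inducedProj M x j (inducedOp p x j 0 i f) = x i • inducedProj M x j f := by
  induction f using Finsupp.induction_linear with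
  | zero => simp
  | add f g hf hg => rw [map_add, map_add, map_add, smul_add, hf, hg]
  | single k m =>
    by_cases hij : i = j
    · subst hij
      rw [inducedOp_self, inducedProj_single, inducedProj_single, pow_succ', mul_smul]
    · rw [inducedOp_of_ne hij, inducedProj_single, inducedProj_single, smul_smul, h.gen_mul_pow,
        smul_comm, smul_assoc, mul_smul, add_zero]

/-- The inclusion either raises the index or applies `x j`. Both cost one more factor `p i j` when
`x i` is moved across, hence offset `1` on the source and `0` on the target. -/
theorem IsQuantumAffine.inducedIncl_inducedOp (h : IsQuantumAffine p x) (i j : Fin N)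
    (f : ℕ →₀ M) :
    inducedIncl M x j (inducedOp p x j 1 i f) = inducedOp p x j 0 i (inducedIncl M x j f) := by
  induction f using Finsupp.induction_linear with
  | zero => simp
  | add f g hf hg => rw [map_add, map_add, map_add, map_add, hf, hg]
  | single k m =>
    by_cases hij : i = j
    · subst hij
      simp only [inducedOp_self, inducedIncl_single, map_sub]
    · simp only [inducedOp_of_ne hij, inducedIncl_single, map_sub, add_zero]
      congr 2
      rw [smul_smul (x i), h.comm i j, smul_assoc, smul_comm (x j), smul_smul,
        smul_smul, pow_succ]

variable (M) in
/-- The short exact sequence resolving `M` by modules induced in the direction `j`. -/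
noncomputable def IsQuantumAffine.inducedComplex (h : IsQuantumAffine p x) (j : Fin N) :
    ShortComplex (ModuleCat.{0} R) :=
  .mk (X₁ := .of R (RepModule (h.inducedRep M j 1))) (X₂ := .of R (RepModule (h.inducedRep M j 0)))
    (X₃ := .of R M)
    (ModuleCat.ofHom
      { toFun := fun a => RepModule.of _ (inducedIncl M x j ((RepModule.of _).symm a))
        map_add' := by simp
        map_smul' := h.map_smul_of_gen
          ((RepModule.of _).toLinearMap ∘ₗ inducedIncl M x j ∘ₗ (RepModule.of _).symm.toLinearMap)
          fun i a => by
            obtain ⟨a, rfl⟩ := (RepModule.of _).surjective a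
            simp [RepModule.smul_of, h.inducedRep_gen, h.inducedIncl_inducedOp] })
    (ModuleCat.ofHom
      { toFun := fun a => inducedProj M x j ((RepModule.of _).symm a)
        map_add' := by simp
        map_smul' := h.map_smul_of_gen
          (inducedProj M x j ∘ₗ (RepModule.of _).symm.toLinearMap)
          fun i a => by
            obtain ⟨a, rfl⟩ := (RepModule.of _).surjective a
            simp [RepModule.smul_of, h.inducedRep_gen, h.inducedProj_inducedOp] })
    (by
      ext a
      exact (inducedIncl_exact (x := x) j _).2 ⟨_, rfl⟩)

theorem IsQuantumAffine.inducedComplex_shortExact (h : IsQuantumAffine p x) (j : Fin N) :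
    (h.inducedComplex M j).ShortExact where
  exact := by
    rw [ShortComplex.ShortExact.moduleCat_exact_iff_function_exact]
    exact inducedIncl_exact (M := M) (x := x) j
  mono_f := (ModuleCat.mono_iff_injective _).2 (inducedIncl_injective (M := M) (x := x) j)
  epi_g := (ModuleCat.epi_iff_surjective _).2 (inducedProj_surjective (M := M) (x := x) j)

end

/-! ### Freeness in some directions and the bound on projective dimension -/

/-- `M` is freely generated by a family of vectors under the action of the monomials in the
generators `x j`, `j ∈ J`. -/
def IsFreeAlong {N : ℕ} {R : Type} [Ring R] (x : Fin N → R) (J : Finset (Fin N))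
    (M : Type) [AddCommGroup M] [Module ℂ M] [Module R M] : Prop :=
  ∃ (ι : Type) (v : ι → M)
    (b : Module.Basis ({s : Multiset (Fin N) // ∀ a ∈ s, a ∈ J} × ι) ℂ M),
    ∀ s i, ∃ c : ℂ, c ≠ 0 ∧ b (s, i) = c • monomialOf x s • v i

/-- Splitting off the multiplicity of `j` from a multiset. -/
def multisetInsertEquiv {α : Type} [DecidableEq α] {J : Finset α} {j : α} (hj : j ∉ J) :
    {s : Multiset α // ∀ a ∈ s, a ∈ insert j J} ≃ ℕ × {s : Multiset α // ∀ a ∈ s, a ∈ J} where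
  toFun s := (s.1.count j, ⟨s.1.filter (· ≠ j), fun a ha => by
    rw [Multiset.mem_filter] at ha
    exact (Finset.mem_insert.1 (s.2 a ha.1)).resolve_left ha.2⟩)
  invFun t := ⟨Multiset.replicate t.1 j + t.2.1, fun a ha => by
    rcases Multiset.mem_add.1 ha with ha | ha
    · exact Finset.mem_insert.2 (Or.inl (Multiset.eq_of_mem_replicate ha))
    · exact Finset.mem_insert_of_mem (t.2.2 a ha)⟩
  left_inv s := by
    ext1
    simp only
    rw [← Multiset.filter_eq', Multiset.filter_add_not]
  right_inv t := by
    obtain ⟨k, s, hs⟩ := t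
    have hjs : j ∉ s := fun h => hj (hs j h)
    ext1
    · simp [Multiset.count_eq_zero_of_notMem hjs]
    · ext1
      simp only [Multiset.filter_add]
      rw [Multiset.filter_eq_nil.2 fun a ha => by simpa using Multiset.eq_of_mem_replicate ha,
        zero_add, Multiset.filter_eq_self]
      rintro a ha rfl
      exact hjs ha

theorem isFreeAlong_empty {N : ℕ} {R : Type} [Ring R] (x : Fin N → R) (M : Type) [AddCommGroup M] [Module ℂ M] [Module R M] :
    IsFreeAlong x ∅ M := by
  let b := Module.Basis.ofVectorSpace ℂ M
  let _ : Unique {s : Multiset (Fin N) // ∀ a ∈ s, a ∈ (∅ : Finset (Fin N))} :=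
    { default := ⟨0, by simp⟩
      uniq := fun s => Subtype.ext (Multiset.eq_zero_of_forall_notMem fun a ha => by
        simpa using s.2 a ha) }
  refine ⟨_, b, b.reindex (Equiv.uniqueProd _ _).symm, fun s i => ⟨1, one_ne_zero, ?_⟩⟩
  obtain rfl := Subsingleton.elim default s
  change _ = (1 : ℂ) • monomialOf x 0 • b i
  simp [b]

section

variable {N : ℕ} {R M : Type} [Ring R] [Algebra ℂ R] [AddCommGroup M]
  [Module ℂ M] [Module R M] [IsScalarTower ℂ R M] {p : Fin N → Fin N → ℂ} {x : Fin N → R}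

/-- Letters other than `j` act on the coefficient at index `0` up to scalars; the `k` letters `j`
then shift it to index `k`. -/
theorem IsQuantumAffine.exists_smul_single (h : IsQuantumAffine p x) {j : Fin N} (e k : ℕ)
    {s : Multiset (Fin N)} (hj : j ∉ s) (m : M) :
    ∃ c : ℂ, c ≠ 0 ∧ monomialOf x (Multiset.replicate k j + s) •
      RepModule.of (h.inducedRep M j e) (Finsupp.single 0 m) =
        RepModule.of _ (Finsupp.single k (c • monomialOf x s • m)) := by
  have hw : ∀ l : List (Fin N), j ∉ l → ∃ c : ℂ, c ≠ 0 ∧ (l.map x).prod •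
      RepModule.of (h.inducedRep M j e) (Finsupp.single 0 m) =
        RepModule.of _ (Finsupp.single 0 (c • (l.map x).prod • m)) := by
    intro l hl
    induction l with
    | nil => exact ⟨1, one_ne_zero, by simp⟩
    | cons i l ih =>
      obtain ⟨c, hc, hm⟩ := ih fun hjl => hl (List.mem_cons_of_mem _ hjl)
      have hij : i ≠ j := fun hij => hl (hij ▸ List.mem_cons_self)
      refine ⟨p i j ^ e * c, mul_ne_zero (pow_ne_zero _ (h.param_ne_zero i j)) hc, ?_⟩
      rw [List.map_cons, List.prod_cons, mul_smul, hm, RepModule.smul_of, h.inducedRep_gen,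
        inducedOp_of_ne hij, zero_add, smul_comm (x i) c, smul_smul, mul_smul (x i)]
  have hp : ∀ m : M, x j ^ k • RepModule.of (h.inducedRep M j e) (Finsupp.single 0 m) =
      RepModule.of _ (Finsupp.single k m) := by
    intro m
    induction k with
    | zero => simp
    | succ k ih =>
      rw [pow_succ', mul_smul, ih, RepModule.smul_of, h.inducedRep_gen, inducedOp_self]
  obtain ⟨c, hc, hm⟩ := hw s.toList (by simpa using hj)
  obtain ⟨d, hd, hl⟩ := h.exists_list_prod_eq (List.replicate k j ++ s.toList)
  rw [← Multiset.coe_add, Multiset.coe_toList, Multiset.coe_replicate, List.map_append,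
    List.prod_append, List.map_replicate, List.prod_replicate] at hl
  refine ⟨d⁻¹ * c, mul_ne_zero (inv_ne_zero hd) hc, ?_⟩
  rw [eq_inv_smul_iff₀ hd |>.2 hl.symm, smul_assoc, mul_smul, hm, hp,
    mul_smul d⁻¹ c, ← Finsupp.smul_single d⁻¹, map_smul]
  rfl

theorem IsQuantumAffine.isFreeAlong_insert (h : IsQuantumAffine p x) {J : Finset (Fin N)}
    {j : Fin N} (hj : j ∉ J) (e : ℕ) (hM : IsFreeAlong x J M) :
    IsFreeAlong x (insert j J) (RepModule (h.inducedRep M j e)) := by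
  obtain ⟨ι, v, b, hb⟩ := hM
  let σ : (Σ _ : ℕ, ({s : Multiset (Fin N) // ∀ a ∈ s, a ∈ J} × ι)) ≃
      {s : Multiset (Fin N) // ∀ a ∈ s, a ∈ insert j J} × ι :=
    (Equiv.sigmaEquivProd _ _).trans ((Equiv.prodAssoc _ _ _).symm.trans
      (Equiv.prodCongr (multisetInsertEquiv hj).symm (Equiv.refl ι)))
  refine ⟨ι, fun i => RepModule.of _ (Finsupp.single 0 (v i)),
    ((Finsupp.basis fun _ => b).reindex σ).map (RepModule.of _), fun s i => ?_⟩
  obtain ⟨⟨k, t⟩, rfl⟩ := (multisetInsertEquiv hj).symm.surjective s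
  obtain ⟨c, hc, ht⟩ := hb t i
  obtain ⟨d, hd, hs⟩ := h.exists_smul_single e k (fun hjt => hj (t.2 j hjt)) (v i)
  refine ⟨c * d⁻¹, mul_ne_zero hc (inv_ne_zero hd), ?_⟩
  have hσ : σ.symm ((multisetInsertEquiv hj).symm (k, t), i) = ⟨k, t, i⟩ := by
    simp [σ]
  rw [Module.Basis.map_apply, Module.Basis.reindex_apply, hσ, Finsupp.coe_basis]
  change RepModule.of _ (Finsupp.single k (b (t, i))) =
    _ • monomialOf x (Multiset.replicate k j + t.1) • _
  rw [hs, ht, mul_smul c, ← Finsupp.smul_single c, ← Finsupp.smul_single d, map_smul,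
    map_smul, inv_smul_smul₀ hd]

theorem IsQuantumAffine.projective_of_isFreeAlong_univ (h : IsQuantumAffine p x)
    (hM : IsFreeAlong x Finset.univ M) : Module.Projective R M := by
  obtain ⟨ι, v, b, hb⟩ := hM
  choose c hc hb using hb
  let f : (ι →₀ R) →ₗ[R] M := Finsupp.linearCombination R v
  let σ : ({s : Multiset (Fin N) // ∀ a ∈ s, a ∈ Finset.univ} × ι) ≃ (Σ _ : ι, Multiset (Fin N)) :=
    ((Equiv.prodCongr (Equiv.subtypeUnivEquiv fun s a _ => Finset.mem_univ a)
      (Equiv.refl ι)).trans (Equiv.prodComm _ _)).trans (Equiv.sigmaEquivProd _ _).symm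
  let E : (ι →₀ R) ≃ₗ[ℂ] M := (Finsupp.basis fun _ : ι => h.basis).equiv
    (b.unitsSMul fun q => (Units.mk0 (c q.1 q.2) (hc q.1 q.2))⁻¹) σ.symm
  have hE : f.restrictScalars ℂ = E.toLinearMap := by
    refine (Finsupp.basis fun _ : ι => h.basis).ext fun ⟨i, s⟩ => ?_
    have hσ : σ.symm ⟨i, s⟩ = (⟨s, fun a _ => Finset.mem_univ a⟩, i) := rfl
    rw [LinearEquiv.coe_coe, Module.Basis.equiv_apply, hσ, Module.Basis.unitsSMul_apply, hb,
      Units.smul_def, Units.val_inv_eq_inv_val, Units.val_mk0, inv_smul_smul₀ (hc _ _)]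
    simp [f]
  have hf : Function.Bijective f := by
    have : ⇑f = E := congrArg DFunLike.coe hE
    rw [this]
    exact E.bijective
  exact Module.Projective.of_equiv (LinearEquiv.ofBijective f hf)

/-- Induction on the number of directions in which `M` is not yet known to be free: both induced
modules gain the direction `j`, and the resolution costs one dimension. -/
theorem IsQuantumAffine.hasProjectiveDimensionLE_of_isFreeAlong (h : IsQuantumAffine p x)
    (k : ℕ) (J : Finset (Fin N)) (hJ : Jᶜ.card = k) (M : Type) [AddCommGroup M]
    [Module ℂ M] [Module R M] [IsScalarTower ℂ R M] (hM : IsFreeAlong x J M) :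
    HasProjectiveDimensionLE (ModuleCat.of R M) k := by
  induction k generalizing J M with
  | zero =>
    rw [Finset.card_eq_zero, Finset.compl_eq_empty_iff] at hJ
    subst hJ
    have := h.projective_of_isFreeAlong_univ hM
    rw [← projective_iff_hasProjectiveDimensionLE_zero]
    exact (IsProjective.iff_projective M).1 this
  | succ k ih =>
    obtain ⟨j, hj⟩ := Finset.card_pos.1 (by omega : 0 < Jᶜ.card)
    have hjJ := Finset.mem_compl.1 hj
    have hc : (insert j J)ᶜ.card = k := by
      rw [Finset.compl_insert, Finset.card_erase_of_mem hj, hJ, Nat.add_sub_cancel]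
    have h0 := ih _ hc _ (h.isFreeAlong_insert hjJ 0 hM)
    have h1 := ih _ hc _ (h.isFreeAlong_insert hjJ 1 hM)
    -- Dimension `≤ k` means `< k + 1`; the middle term only needs the weaker bound `< k + 2`.
    exact (h.inducedComplex_shortExact (M := M) j).hasProjectiveDimensionLT_X₃ (k + 1) h1
      (@hasProjectiveDimensionLT_of_ge _ _ _ _ (k + 1) _ (by omega) h0)

/-- Every module over a quantum affine space in `N` variables has projective dimension at most
`N`. -/
theorem IsQuantumAffine.hasProjectiveDimensionLE (h : IsQuantumAffine p x)
    (M : ModuleCat.{0} R) : HasProjectiveDimensionLE M N := by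
  let _ : Module ℂ M := Module.compHom M (algebraMap ℂ R)
  have : IsScalarTower ℂ R M := ⟨fun c r m => by
    rw [Algebra.smul_def, mul_smul]
    rfl⟩
  exact h.hasProjectiveDimensionLE_of_isFreeAlong N ∅ (by simp) M (isFreeAlong_empty x M)

end

/-! ### Monomial ideals and their quotients -/

/-- The span of the monomials which involve one of the `x a`, `a ∈ J`. -/
noncomputable def monomialSpan {N : ℕ} {R : Type} [Ring R] [Algebra ℂ R] (x : Fin N → R)
    (J : Finset (Fin N)) : Submodule ℂ R :=
  Submodule.span ℂ (monomialOf x '' {s | ∃ a ∈ s, a ∈ J})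

namespace IsQuantumAffine

variable {N : ℕ} {R : Type} [Ring R] [Algebra ℂ R] {p : Fin N → Fin N → ℂ} {x : Fin N → R}

theorem mem_monomialSpan_iff (h : IsQuantumAffine p x) {J : Finset (Fin N)} {r : R} :
    r ∈ monomialSpan x J ↔ ∀ s, (∀ a ∈ s, a ∉ J) → h.basis.repr r s = 0 := by
  have : monomialOf x = h.basis := by
    ext s
    simp
  rw [monomialSpan, this, Module.Basis.mem_span_image]
  constructor
  · intro hr s hs
    by_contra hne
    obtain ⟨a, ha, haJ⟩ := hr (Finset.mem_coe.2 (Finsupp.mem_support_iff.2 hne))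
    exact hs a ha haJ
  · intro hr s hs
    by_contra hne
    refine Finsupp.mem_support_iff.1 (Finset.mem_coe.1 hs) (hr s fun a ha haJ => hne ⟨a, ha, haJ⟩)

theorem mul_mem_monomialSpan_right (h : IsQuantumAffine p x) {J : Finset (Fin N)} (r : R) {a : R}
    (ha : a ∈ monomialSpan x J) : r * a ∈ monomialSpan x J := by
  have hr : r ∈ Submodule.span ℂ (Set.range (monomialOf x)) :=
    h.span_monomialOf ▸ Submodule.mem_top
  have := Submodule.mul_mem_mul hr ha
  rw [monomialSpan, Submodule.span_mul_span] at this
  refine Submodule.span_le.2 ?_ this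
  rintro _ ⟨_, ⟨s, rfl⟩, _, ⟨t, ⟨b, hb, hbJ⟩, rfl⟩, rfl⟩
  obtain ⟨c, -, e⟩ := h.exists_monomialOf_mul s t
  simp only [e]
  exact Submodule.smul_mem _ _ (Submodule.subset_span
    ⟨_, ⟨b, Multiset.mem_add.2 (Or.inr hb), hbJ⟩, rfl⟩)

theorem mul_mem_monomialSpan_left (h : IsQuantumAffine p x) {J : Finset (Fin N)} (r : R) {a : R}
    (ha : a ∈ monomialSpan x J) : a * r ∈ monomialSpan x J := by
  have hr : r ∈ Submodule.span ℂ (Set.range (monomialOf x)) :=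
    h.span_monomialOf ▸ Submodule.mem_top
  have := Submodule.mul_mem_mul ha hr
  rw [monomialSpan, Submodule.span_mul_span] at this
  refine Submodule.span_le.2 ?_ this
  rintro _ ⟨_, ⟨t, ⟨b, hb, hbJ⟩, rfl⟩, _, ⟨s, rfl⟩, rfl⟩
  obtain ⟨c, -, e⟩ := h.exists_monomialOf_mul t s
  simp only [e]
  exact Submodule.smul_mem _ _ (Submodule.subset_span
    ⟨_, ⟨b, Multiset.mem_add.2 (Or.inl hb), hbJ⟩, rfl⟩)

/-- A linear endomorphism which, up to nonzero scalars, shifts the monomials by `l ∉ J` reflects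
membership in the span of the monomials involving `J`. -/
theorem mem_monomialSpan_of_shift (h : IsQuantumAffine p x) {J : Finset (Fin N)} {l : Fin N}
    (hl : l ∉ J) (φ : R →ₗ[ℂ] R)
    (hφ : ∀ s, ∃ c : ℂ, c ≠ 0 ∧ φ (monomialOf x s) = c • monomialOf x (l ::ₘ s)) {r : R}
    (hr : φ r ∈ monomialSpan x J) : r ∈ monomialSpan x J := by
  choose c hc hφ using hφ
  -- Adding `l` is injective on multisets, so coefficients are only relabelled and rescaled; since
  -- `l ∉ J`, a multiset avoiding `J` still avoids it afterwards.
  have key : ∀ s r, h.basis.repr (φ r) (l ::ₘ s) = c s * h.basis.repr r s := by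
    intro s r
    have : Finsupp.lapply (l ::ₘ s) ∘ₗ h.basis.repr.toLinearMap ∘ₗ φ =
        c s • (Finsupp.lapply s ∘ₗ h.basis.repr.toLinearMap) := by
      refine h.basis.ext fun t => ?_
      have ht : φ (h.basis t) = c t • h.basis (l ::ₘ t) := by simp [hφ]
      simp only [LinearMap.comp_apply, ht, map_smul, LinearMap.smul_apply, LinearEquiv.coe_coe,
        Module.Basis.repr_self, Finsupp.lapply_apply, Finsupp.single_apply,
        Multiset.cons_inj_right]
      split_ifs with hts
      · rw [hts]
      · simp
    exact LinearMap.congr_fun this r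
  rw [h.mem_monomialSpan_iff] at hr ⊢
  intro s hs
  have := hr (l ::ₘ s) fun a ha => (Multiset.mem_cons.1 ha).elim (fun e => e ▸ hl) (hs a)
  rw [key] at this
  exact (mul_eq_zero.1 this).resolve_left (hc s)

theorem mem_monomialSpan_of_mul_left (h : IsQuantumAffine p x) {J : Finset (Fin N)} {l : Fin N}
    (hl : l ∉ J) {r : R} (hr : x l * r ∈ monomialSpan x J) : r ∈ monomialSpan x J :=
  h.mem_monomialSpan_of_shift hl (LinearMap.mulLeft ℂ (x l)) (h.exists_mul_monomialOf l) hr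

theorem mem_monomialSpan_of_mul_right (h : IsQuantumAffine p x) {J : Finset (Fin N)} {l : Fin N}
    (hl : l ∉ J) {r : R} (hr : r * x l ∈ monomialSpan x J) : r ∈ monomialSpan x J :=
  h.mem_monomialSpan_of_shift hl (LinearMap.mulRight ℂ (x l)) (h.exists_monomialOf_mul_gen l) hr

theorem monomialSpan_mono {J J' : Finset (Fin N)} (hJ : J ⊆ J') :
    monomialSpan x J ≤ monomialSpan x J' :=
  Submodule.span_mono (Set.image_mono fun _ ⟨a, ha, haJ⟩ => ⟨a, ha, hJ haJ⟩)

theorem gen_mem_monomialSpan {J : Finset (Fin N)} {l : Fin N} (hl : l ∈ J) :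
    x l ∈ monomialSpan x J :=
  Submodule.subset_span ⟨{l}, ⟨l, Multiset.mem_singleton_self l, hl⟩, by simp⟩

/-- A monomial containing `l` is, up to a scalar, `φ` of the monomial with one `l` removed; the
other monomials already involve `J`. -/
theorem exists_of_mem_monomialSpan_insert {J : Finset (Fin N)} {l : Fin N}
    (φ : R →ₗ[ℂ] R)
    (hφ : ∀ s, ∃ c : ℂ, c ≠ 0 ∧ φ (monomialOf x s) = c • monomialOf x (l ::ₘ s)) {r : R}
    (hr : r ∈ monomialSpan x (insert l J)) : ∃ a, r - φ a ∈ monomialSpan x J := by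
  suffices monomialSpan x (insert l J) ≤ monomialSpan x J ⊔ LinearMap.range φ by
    obtain ⟨y, hy, _, ⟨a, rfl⟩, rfl⟩ := Submodule.mem_sup.1 (this hr)
    exact ⟨a, by simpa using hy⟩
  refine Submodule.span_le.2 ?_
  rintro _ ⟨s, ⟨a, ha, haJ⟩, rfl⟩
  rcases Finset.mem_insert.1 haJ with rfl | haJ
  · obtain ⟨t, rfl⟩ := Multiset.exists_cons_of_mem ha
    obtain ⟨c, hc, e⟩ := hφ t
    refine Submodule.mem_sup_right ⟨c⁻¹ • monomialOf x t, ?_⟩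
    rw [map_smul, e, inv_smul_smul₀ hc]
  · exact Submodule.mem_sup_left (Submodule.subset_span ⟨s, ⟨a, ha, haJ⟩, rfl⟩)

theorem mem_monomialSpan_insert_iff_left (h : IsQuantumAffine p x) {J : Finset (Fin N)}
    {l : Fin N} {r : R} :
    r ∈ monomialSpan x (insert l J) ↔ ∃ a, r - x l * a ∈ monomialSpan x J := by
  refine ⟨exists_of_mem_monomialSpan_insert (LinearMap.mulLeft ℂ (x l))
    (h.exists_mul_monomialOf l), fun ⟨a, ha⟩ => ?_⟩
  rw [← sub_add_cancel r (x l * a)]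
  exact add_mem (monomialSpan_mono (Finset.subset_insert l J) ha)
    (h.mul_mem_monomialSpan_left a (gen_mem_monomialSpan (Finset.mem_insert_self l J)))

theorem mem_monomialSpan_insert_iff_right (h : IsQuantumAffine p x) {J : Finset (Fin N)}
    {l : Fin N} {r : R} :
    r ∈ monomialSpan x (insert l J) ↔ ∃ a, r - a * x l ∈ monomialSpan x J := by
  refine ⟨exists_of_mem_monomialSpan_insert (LinearMap.mulRight ℂ (x l))
    (h.exists_monomialOf_mul_gen l), fun ⟨a, ha⟩ => ?_⟩
  rw [← sub_add_cancel r (a * x l)]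
  exact add_mem (monomialSpan_mono (Finset.subset_insert l J) ha)
    (h.mul_mem_monomialSpan_right a (gen_mem_monomialSpan (Finset.mem_insert_self l J)))

/-- The right ideal generated by the `x a`, `a ∈ J`. -/
noncomputable def rightIdeal (h : IsQuantumAffine p x) (J : Finset (Fin N)) :
    Submodule Rᵐᵒᵖ R where
  toAddSubmonoid := (monomialSpan x J).toAddSubmonoid
  smul_mem' r _ ha := h.mul_mem_monomialSpan_left r.unop ha

/-- The left ideal generated by the `x a`, `a ∈ J`. -/
noncomputable def leftIdeal (h : IsQuantumAffine p x) (J : Finset (Fin N)) :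
    Submodule R R where
  toAddSubmonoid := (monomialSpan x J).toAddSubmonoid
  smul_mem' r _ ha := h.mul_mem_monomialSpan_right r ha

theorem mem_rightIdeal (h : IsQuantumAffine p x) {J : Finset (Fin N)} {r : R} :
    r ∈ h.rightIdeal J ↔ r ∈ monomialSpan x J := Iff.rfl

theorem mem_leftIdeal (h : IsQuantumAffine p x) {J : Finset (Fin N)} {r : R} :
    r ∈ h.leftIdeal J ↔ r ∈ monomialSpan x J := Iff.rfl

/-- Left multiplication by `a` on the right module `R / (x_j, j ∈ J)`. -/
noncomputable def quotMulLeft (h : IsQuantumAffine p x) (J : Finset (Fin N)) (a : R) :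
    (R ⧸ h.rightIdeal J) →ₗ[Rᵐᵒᵖ] (R ⧸ h.rightIdeal J) :=
  (h.rightIdeal J).mapQ (h.rightIdeal J) (Module.toModuleEnd Rᵐᵒᵖ R a)
    fun _ hb => h.mul_mem_monomialSpan_right a hb

theorem quotMulLeft_mk (h : IsQuantumAffine p x) (J : Finset (Fin N)) (a b : R) :
    h.quotMulLeft J a (Submodule.Quotient.mk b) = Submodule.Quotient.mk (a * b) := rfl

/-- Right multiplication by `a` on the left module `R / (x_j, j ∈ J)`. -/
noncomputable def quotMulRight (h : IsQuantumAffine p x) (J : Finset (Fin N)) (a : R) :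
    (R ⧸ h.leftIdeal J) →ₗ[R] (R ⧸ h.leftIdeal J) :=
  (h.leftIdeal J).mapQ (h.leftIdeal J) (LinearMap.toSpanSingleton R R a)
    fun _ hb => h.mul_mem_monomialSpan_left a hb

theorem quotMulRight_mk (h : IsQuantumAffine p x) (J : Finset (Fin N)) (a b : R) :
    h.quotMulRight J a (Submodule.Quotient.mk b) = Submodule.Quotient.mk (b * a) := rfl

theorem quotMulLeft_injective (h : IsQuantumAffine p x) {J : Finset (Fin N)} {l : Fin N}
    (hl : l ∉ J) : Function.Injective (h.quotMulLeft J (x l)) := by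
  rw [injective_iff_map_eq_zero]
  intro a ha
  obtain ⟨a, rfl⟩ := Submodule.Quotient.mk_surjective _ a
  rw [quotMulLeft_mk, Submodule.Quotient.mk_eq_zero] at ha
  exact (Submodule.Quotient.mk_eq_zero _).2 (h.mem_monomialSpan_of_mul_left hl ha)

theorem quotMulRight_injective (h : IsQuantumAffine p x) {J : Finset (Fin N)} {l : Fin N}
    (hl : l ∉ J) {c : ℂ} (hc : c ≠ 0) : Function.Injective (h.quotMulRight J (c • x l)) := by
  rw [injective_iff_map_eq_zero]
  intro a ha
  obtain ⟨a, rfl⟩ := Submodule.Quotient.mk_surjective _ a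
  rw [quotMulRight_mk, Submodule.Quotient.mk_eq_zero, mul_smul_comm, h.mem_leftIdeal,
    Submodule.smul_mem_iff _ hc] at ha
  exact (Submodule.Quotient.mk_eq_zero _).2 (h.mem_monomialSpan_of_mul_right hl ha)

/-- The projection `R / (x_j, j ∈ J) → R / (x_j, j ∈ J ∪ {l})` of right modules. -/
noncomputable def rightQuotProj (h : IsQuantumAffine p x) (J : Finset (Fin N)) (l : Fin N) :
    (R ⧸ h.rightIdeal J) →ₗ[Rᵐᵒᵖ] (R ⧸ h.rightIdeal (insert l J)) :=
  Submodule.factor fun _ hr => monomialSpan_mono (Finset.subset_insert l J) hr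

/-- The projection `R / (x_j, j ∈ J) → R / (x_j, j ∈ J ∪ {l})` of left modules. -/
noncomputable def leftQuotProj (h : IsQuantumAffine p x) (J : Finset (Fin N)) (l : Fin N) :
    (R ⧸ h.leftIdeal J) →ₗ[R] (R ⧸ h.leftIdeal (insert l J)) :=
  Submodule.factor fun _ hr => monomialSpan_mono (Finset.subset_insert l J) hr

theorem rightQuotProj_mk (h : IsQuantumAffine p x) (J : Finset (Fin N)) (l : Fin N) (r : R) :
    h.rightQuotProj J l (Submodule.Quotient.mk r) = Submodule.Quotient.mk r := rfl

theorem leftQuotProj_mk (h : IsQuantumAffine p x) (J : Finset (Fin N)) (l : Fin N) (r : R) :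
    h.leftQuotProj J l (Submodule.Quotient.mk r) = Submodule.Quotient.mk r := rfl

theorem rightQuotProj_surjective (h : IsQuantumAffine p x) (J : Finset (Fin N)) (l : Fin N) :
    Function.Surjective (h.rightQuotProj J l) :=
  Submodule.factor_surjective fun _ hr => monomialSpan_mono (Finset.subset_insert l J) hr

theorem leftQuotProj_surjective (h : IsQuantumAffine p x) (J : Finset (Fin N)) (l : Fin N) :
    Function.Surjective (h.leftQuotProj J l) :=
  Submodule.factor_surjective fun _ hr => monomialSpan_mono (Finset.subset_insert l J) hr

theorem exact_rightQuotProj (h : IsQuantumAffine p x) (J : Finset (Fin N)) (l : Fin N) :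
    Function.Exact (h.quotMulLeft J (x l)) (h.rightQuotProj J l) := by
  intro r
  obtain ⟨r, rfl⟩ := Submodule.Quotient.mk_surjective _ r
  change Submodule.Quotient.mk r = 0 ↔ _
  rw [Submodule.Quotient.mk_eq_zero, h.mem_rightIdeal, h.mem_monomialSpan_insert_iff_left]
  constructor
  · rintro ⟨a, ha⟩
    exact ⟨Submodule.Quotient.mk a, ((Submodule.Quotient.eq (h.rightIdeal J)).2 ha).symm⟩
  · rintro ⟨a, ha⟩
    obtain ⟨a, rfl⟩ := Submodule.Quotient.mk_surjective _ a
    exact ⟨a, (Submodule.Quotient.eq (h.rightIdeal J)).1 ha.symm⟩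

theorem exact_leftQuotProj (h : IsQuantumAffine p x) (J : Finset (Fin N)) (l : Fin N) {c : ℂ}
    (hc : c ≠ 0) : Function.Exact (h.quotMulRight J (c • x l)) (h.leftQuotProj J l) := by
  intro r
  obtain ⟨r, rfl⟩ := Submodule.Quotient.mk_surjective _ r
  change Submodule.Quotient.mk r = 0 ↔ _
  rw [Submodule.Quotient.mk_eq_zero, h.mem_leftIdeal, h.mem_monomialSpan_insert_iff_right]
  constructor
  · rintro ⟨a, ha⟩
    refine ⟨Submodule.Quotient.mk (c⁻¹ • a), ((Submodule.Quotient.eq (h.leftIdeal J)).2 ?_).symm⟩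
    change r - (c⁻¹ • a) * (c • x l) ∈ _
    rwa [smul_mul_smul_comm, inv_mul_cancel₀ hc, one_smul]
  · rintro ⟨a, ha⟩
    obtain ⟨a, rfl⟩ := Submodule.Quotient.mk_surjective _ a
    rw [quotMulRight_mk, mul_smul_comm, ← smul_mul_assoc] at ha
    exact ⟨c • a, (Submodule.Quotient.eq (h.leftIdeal J)).1 ha.symm⟩

end IsQuantumAffine

/-! ### Ext groups of the quotients and the Gorenstein property -/

theorem exists_linearEquiv_of_ker_eq {R E F G : Type} [Ring R] [AddCommGroup E] [Module R E]
    [AddCommGroup F] [Module R F] [AddCommGroup G] [Module R G] (f : E →ₗ[R] F) (g : E →ₗ[R] G)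
    (hf : Function.Surjective f) (hg : Function.Surjective g)
    (hfg : LinearMap.ker f = LinearMap.ker g) : ∃ e : F ≃ₗ[R] G, ∀ a, e (f a) = g a := by
  let e₁ := f.quotKerEquivOfSurjective hf
  let e₂ := g.quotKerEquivOfSurjective hg
  refine ⟨e₁.symm.trans ((Submodule.quotEquivOfEq _ _ hfg).trans e₂), fun a => ?_⟩
  have : e₁.symm (f a) = Submodule.Quotient.mk a := by
    rw [LinearEquiv.symm_apply_eq]
    rfl
  rw [LinearEquiv.trans_apply, this]
  rfl

theorem Ext.smul_def' {A : Type} [Ring A] (X : ModuleCat.{0} Aᵐᵒᵖ) (k : ℕ) (a : A)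
    (e : Ext.{0} X (regularRightModule A) k) :
    a • e = e.comp (Ext.mk₀ (leftMulHom a)) (add_zero k) := rfl

namespace IsQuantumAffine

variable {N : ℕ} {R : Type} [Ring R] [Algebra ℂ R] {p : Fin N → Fin N → ℂ} {x : Fin N → R}

/-- The right module `R / (x_j, j ∈ J)`. -/
noncomputable abbrev quotModule (h : IsQuantumAffine p x) (J : Finset (Fin N)) :
    ModuleCat.{0} Rᵐᵒᵖ :=
  ModuleCat.of Rᵐᵒᵖ (R ⧸ h.rightIdeal J)

/-- Left multiplication by `a` as an endomorphism of `R / (x_j, j ∈ J)`. -/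
noncomputable def quotHom (h : IsQuantumAffine p x) (J : Finset (Fin N)) (a : R) :
    h.quotModule J ⟶ h.quotModule J :=
  ModuleCat.ofHom (h.quotMulLeft J a)

theorem quotHom_comp (h : IsQuantumAffine p x) (J : Finset (Fin N)) (a b : R) :
    h.quotHom J a ≫ h.quotHom J b = h.quotHom J (b * a) := by
  rw [quotHom, quotHom, ← ModuleCat.ofHom_comp, quotHom]
  congr 1
  refine LinearMap.ext fun r => ?_
  obtain ⟨r, rfl⟩ := Submodule.Quotient.mk_surjective _ r
  rw [LinearMap.comp_apply, quotMulLeft_mk, quotMulLeft_mk, quotMulLeft_mk, mul_assoc]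

/-- The multiplication by `x l` on `R / (x_j, j ∈ J)` and its cokernel. -/
noncomputable abbrev quotComplex (h : IsQuantumAffine p x) (J : Finset (Fin N)) (l : Fin N) :
    ShortComplex (ModuleCat.{0} Rᵐᵒᵖ) :=
  .mk (X₁ := h.quotModule J) (X₂ := h.quotModule J) (X₃ := h.quotModule (insert l J))
    (h.quotHom J (x l)) (ModuleCat.ofHom (h.rightQuotProj J l)) (by
      rw [quotHom, ← ModuleCat.ofHom_comp, (h.exact_rightQuotProj J l).linearMap_comp_eq_zero]
      rfl)

theorem quotComplex_shortExact (h : IsQuantumAffine p x) {J : Finset (Fin N)} {l : Fin N}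
    (hl : l ∉ J) : (h.quotComplex J l).ShortExact where
  exact := by
    rw [ShortComplex.ShortExact.moduleCat_exact_iff_function_exact]
    exact h.exact_rightQuotProj J l
  mono_f := (ModuleCat.mono_iff_injective _).2 (h.quotMulLeft_injective hl)
  epi_g := (ModuleCat.epi_iff_surjective _).2 (h.rightQuotProj_surjective J l)

/-- The endomorphism of `quotComplex` given by multiplication by a multiple of `x i`. -/
noncomputable def quotComplexHom (h : IsQuantumAffine p x) (J : Finset (Fin N)) (l i : Fin N)
    (a : ℂ) : h.quotComplex J l ⟶ h.quotComplex J l where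
  -- The extra `p i l` arises from `x i * x l = p i l • (x l * x i)` and makes the left square
  -- commute.
  τ₁ := h.quotHom J ((a * p i l) • x i)
  τ₂ := h.quotHom J (a • x i)
  τ₃ := h.quotHom (insert l J) (a • x i)
  comm₁₂ := by
    rw [quotHom_comp, quotHom_comp, mul_smul_comm, smul_mul_assoc a (x i), h.comm i l, smul_smul]
  comm₂₃ := by
    rw [quotHom, quotHom, ← ModuleCat.ofHom_comp, ← ModuleCat.ofHom_comp]
    congr 1
    refine LinearMap.ext fun r => ?_
    obtain ⟨r, rfl⟩ := Submodule.Quotient.mk_surjective _ r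
    rw [LinearMap.comp_apply, LinearMap.comp_apply, quotMulLeft_mk, rightQuotProj_mk,
      rightQuotProj_mk, quotMulLeft_mk]

/-- `Ext (R / (x_j, j ∈ J), R)` is concentrated in degree `d`, where it is `R / (x_j, j ∈ J)`,
and the multiplications by the other generators correspond to each other up to scalars. -/
structure IsGorensteinAt (h : IsQuantumAffine p x) (J : Finset (Fin N)) (d : ℕ) : Prop where
  subsingleton : ∀ k, k ≠ d → Subsingleton (Ext.{0} (h.quotModule J) (regularRightModule R) k)
  exists_equiv : ∃ Φ : Ext.{0} (h.quotModule J) (regularRightModule R) d ≃ₗ[R] R ⧸ h.leftIdeal J,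
    ∀ l ∉ J, ∀ a : ℂ, a ≠ 0 → ∃ c : ℂ, c ≠ 0 ∧ ∀ e,
      Φ ((Ext.mk₀ (h.quotHom J (a • x l))).comp e (zero_add d)) = h.quotMulRight J (c • x l) (Φ e)

theorem monomialSpan_empty : monomialSpan x ∅ = ⊥ := by
  simp [monomialSpan]

/-- Here the quotient is `R` itself, free of rank one. Evaluation at `1` identifies its
homomorphisms to `R` with `R`, and turns precomposition with a left multiplication into a right
multiplication. -/
theorem isGorensteinAt_empty (h : IsQuantumAffine p x) : h.IsGorensteinAt ∅ 0 where
  subsingleton k hk := by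
    have hbot : h.rightIdeal ∅ = ⊥ := by
      ext r
      rw [h.mem_rightIdeal, monomialSpan_empty, Submodule.mem_bot, Submodule.mem_bot]
    let e : (R ⧸ h.rightIdeal ∅) ≃ₗ[Rᵐᵒᵖ] Rᵐᵒᵖ :=
      (Submodule.quotEquivOfEqBot _ hbot).trans
        { toFun := MulOpposite.op
          invFun := MulOpposite.unop
          map_add' := fun _ _ => rfl
          map_smul' := fun _ _ => rfl }
    have : Module.Projective Rᵐᵒᵖ (R ⧸ h.rightIdeal ∅) := Module.Projective.of_equiv e.symm
    have : Projective (h.quotModule ∅) := (IsProjective.iff_projective _).1 this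
    exact HasProjectiveDimensionLT.subsingleton _ 1 k (by omega) _
  exists_equiv := by
    let φ : Ext.{0} (h.quotModule ∅) (regularRightModule R) 0 →ₗ[R] R ⧸ h.leftIdeal ∅ :=
      { toFun := fun e => Submodule.Quotient.mk
          ((Ext.addEquiv₀ e).hom (Submodule.Quotient.mk (1 : R)) : R)
        map_add' := fun e f => by
          rw [map_add]
          rfl
        map_smul' := fun a e => by
          obtain ⟨f, rfl⟩ := Ext.addEquiv₀.symm.surjective e
          rw [Ext.smul_def', Ext.addEquiv₀_symm_apply, Ext.mk₀_comp_mk₀,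
            ← Ext.addEquiv₀_symm_apply, ← Ext.addEquiv₀_symm_apply, AddEquiv.apply_symm_apply,
            AddEquiv.apply_symm_apply]
          rfl }
    have hφ : ∀ f : h.quotModule ∅ ⟶ regularRightModule R,
        φ (Ext.mk₀ f) = Submodule.Quotient.mk (f.hom (Submodule.Quotient.mk (1 : R)) : R) := by
      intro f
      change Submodule.Quotient.mk
        ((Ext.addEquiv₀ (Ext.mk₀ f)).hom (Submodule.Quotient.mk (1 : R)) : R) = _
      rw [← Ext.addEquiv₀_symm_apply, AddEquiv.apply_symm_apply]
    have hmk : ∀ (f : h.quotModule ∅ ⟶ regularRightModule R) (r : R),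
        (f.hom (Submodule.Quotient.mk r) : R) = f.hom (Submodule.Quotient.mk (1 : R)) * r := by
      intro f r
      have : (Submodule.Quotient.mk r : R ⧸ h.rightIdeal ∅) =
          MulOpposite.op r • Submodule.Quotient.mk (1 : R) := by
        rw [← Submodule.Quotient.mk_smul, MulOpposite.smul_eq_mul_unop, one_mul,
          MulOpposite.unop_op]
      rw [this, map_smul]
      rfl
    have hinj : Function.Injective φ := by
      rw [injective_iff_map_eq_zero]
      intro e he
      obtain ⟨f, rfl⟩ := Ext.addEquiv₀.symm.surjective e
      rw [Ext.addEquiv₀_symm_apply] at he ⊢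
      rw [hφ, Submodule.Quotient.mk_eq_zero, h.mem_leftIdeal, monomialSpan_empty,
        Submodule.mem_bot] at he
      rw [Ext.mk₀_eq_zero_iff]
      refine ModuleCat.hom_ext (LinearMap.ext fun r => ?_)
      obtain ⟨r, rfl⟩ := Submodule.Quotient.mk_surjective _ r
      exact (hmk f r).trans (by rw [he, zero_mul]; rfl)
    have hsurj : Function.Surjective φ := by
      intro r
      obtain ⟨r, rfl⟩ := Submodule.Quotient.mk_surjective _ r
      let f : (R ⧸ h.rightIdeal ∅) →ₗ[Rᵐᵒᵖ] R :=
        (h.rightIdeal ∅).liftQ (Module.toModuleEnd Rᵐᵒᵖ R r) fun a ha => by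
          rw [h.mem_rightIdeal, monomialSpan_empty, Submodule.mem_bot] at ha
          simp [ha]
      refine ⟨Ext.mk₀ (ModuleCat.ofHom f), ?_⟩
      rw [hφ]
      change Submodule.Quotient.mk (r * 1) = _
      rw [mul_one]
    refine ⟨LinearEquiv.ofBijective φ ⟨hinj, hsurj⟩, fun l _ a ha => ⟨a, ha, fun e => ?_⟩⟩
    obtain ⟨f, rfl⟩ := Ext.addEquiv₀.symm.surjective e
    rw [Ext.addEquiv₀_symm_apply, Ext.mk₀_comp_mk₀]
    change φ _ = h.quotMulRight ∅ (a • x l) (φ _)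
    rw [hφ, hφ, quotMulRight_mk, ← hmk]
    change Submodule.Quotient.mk (f.hom (Submodule.Quotient.mk ((a • x l) * 1)) : R) = _
    rw [mul_one]

/-- Under `Φ`, multiplication by `x l` on `Ext^d` becomes right multiplication by `c • x l`, which
is injective with cokernel the next left quotient. The long exact sequence identifies that cokernel
with `Ext^(d+1)`. -/
theorem IsGorensteinAt.insert {h : IsQuantumAffine p x} {J : Finset (Fin N)} {d : ℕ}
    (hJ : h.IsGorensteinAt J d) {l : Fin N} (hl : l ∉ J) :
    h.IsGorensteinAt (insert l J) (d + 1) := by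
  obtain ⟨hsub, Φ, hΦ⟩ := hJ
  have hS := h.quotComplex_shortExact hl
  obtain ⟨c, hc, hcΦ⟩ := hΦ l hl 1 one_ne_zero
  rw [one_smul] at hcΦ
  have hinj : ∀ k (e : Ext.{0} (h.quotModule J) (regularRightModule R) k),
      (Ext.mk₀ (h.quotHom J (x l))).comp e (zero_add k) = 0 → e = 0 := by
    intro k e he
    by_cases hk : k = d
    · subst hk
      have := hcΦ e
      rw [he, map_zero] at this
      have h0 := (injective_iff_map_eq_zero _).1 (h.quotMulRight_injective hl hc) _ this.symm
      exact Φ.map_eq_zero_iff.1 h0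
    · have := hsub k hk
      exact Subsingleton.elim _ _
  -- The map induced by the projection vanishes: following it by the injective map of `hinj` gives
  -- precomposition with `f ≫ g = 0`. Connecting maps are therefore surjective.
  have hg : ∀ k (e : Ext.{0} (h.quotModule (Insert.insert l J)) (regularRightModule R) k),
      (Ext.mk₀ (h.quotComplex J l).g).comp e (zero_add k) = 0 := by
    intro k e
    refine hinj k _ ?_
    change (Ext.mk₀ (h.quotComplex J l).f).comp _ _ = 0
    rw [Ext.mk₀_comp_mk₀_assoc, ShortComplex.zero, Ext.mk₀_zero, Ext.zero_comp]
  let δ : Ext.{0} (h.quotModule J) (regularRightModule R) d →ₗ[R]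
      Ext.{0} (h.quotModule (Insert.insert l J)) (regularRightModule R) (d + 1) :=
    { toFun := fun e => hS.extClass.comp e (add_comm 1 d)
      map_add' := fun e f => Ext.comp_add _ _ _ _
      map_smul' := fun a e => by
        rw [Ext.smul_def', RingHom.id_apply, Ext.smul_def', Ext.comp_assoc_of_third_deg_zero] }
  have hδ : Function.Surjective δ := fun e =>
    Ext.contravariant_sequence_exact₃ hS _ e (hg _ e) (add_comm 1 d)
  -- Both surjections have kernel the image of multiplication by `x l`: for `δ` by the long exact
  -- sequence, for the projection by exactness of the left quotients transported through `Φ`.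
  obtain ⟨Ψ, hΨ⟩ := exists_linearEquiv_of_ker_eq δ (h.leftQuotProj J l ∘ₗ Φ.toLinearMap) hδ
    ((h.leftQuotProj_surjective J l).comp Φ.surjective) (by
      ext e
      rw [LinearMap.mem_ker, LinearMap.mem_ker]
      have hiff : δ e = 0 ↔ ∃ f, (Ext.mk₀ (h.quotHom J (x l))).comp f (zero_add d) = e :=
        ⟨fun he => Ext.contravariant_sequence_exact₁ hS _ e (add_comm 1 d) he, by
          rintro ⟨f, rfl⟩
          exact hS.extClass_comp_assoc f (h := add_comm 1 d)⟩
      rw [hiff]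
      refine Iff.trans ?_ (h.exact_leftQuotProj J l hc (Φ e)).symm
      constructor
      · rintro ⟨f, rfl⟩
        exact ⟨Φ f, (hcΦ f).symm⟩
      · rintro ⟨r, hr⟩
        refine ⟨Φ.symm r, Φ.injective ?_⟩
        rw [hcΦ, LinearEquiv.apply_symm_apply, hr])
  refine ⟨fun k hk => ⟨fun e f => ?_⟩, Ψ, fun i hi a ha => ?_⟩
  · rw [← sub_eq_zero]
    generalize e - f = e
    cases k with
    | zero =>
      have := hS.epi_g
      refine Ext.precomp_mk₀_injective_of_epi (regularRightModule R) (h.quotComplex J l).g ?_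
      rw [map_zero]
      exact hg 0 e
    | succ k =>
      obtain ⟨f, rfl⟩ := Ext.contravariant_sequence_exact₃ hS _ e (hg _ e) (add_comm 1 k)
      have := hsub k (by omega)
      rw [Subsingleton.elim f 0, Ext.comp_zero]
  -- The scalar is that of `τ₁` in `quotComplexHom`: naturality of the extension class moves `a • x
  -- i` on the cokernel to this multiple on the subobject.
  · obtain ⟨c', hc', hcΦ'⟩ := hΦ i (fun hiJ => hi (Finset.mem_insert_of_mem hiJ)) (a * p i l)
      (mul_ne_zero ha (h.param_ne_zero i l))
    refine ⟨c', hc', fun e => ?_⟩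
    obtain ⟨e, rfl⟩ := hδ e
    have hnat : (Ext.mk₀ (h.quotHom (Insert.insert l J) (a • x i))).comp (δ e)
        (zero_add (d + 1)) =
          δ ((Ext.mk₀ (h.quotHom J ((a * p i l) • x i))).comp e (zero_add d)) := by
      have hn := hS.extClass_naturality hS (h.quotComplexHom J l i a)
      change (Ext.mk₀ (h.quotComplexHom J l i a).τ₃).comp (hS.extClass.comp e (add_comm 1 d)) _ =
        hS.extClass.comp ((Ext.mk₀ (h.quotComplexHom J l i a).τ₁).comp e (zero_add d))
          (add_comm 1 d)
      rw [← Ext.comp_assoc_of_second_deg_zero, hn,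
        Ext.comp_assoc _ _ _ (zero_add 1) (add_comm 1 d) (by omega)]
    rw [hnat, hΨ, hΨ, LinearMap.comp_apply, LinearMap.comp_apply, LinearEquiv.coe_coe, hcΦ']
    obtain ⟨r, hr⟩ := Submodule.Quotient.mk_surjective _ (Φ e)
    rw [← hr, quotMulRight_mk, leftQuotProj_mk, leftQuotProj_mk, quotMulRight_mk]

theorem isGorensteinAt (h : IsQuantumAffine p x) (J : Finset (Fin N)) :
    h.IsGorensteinAt J J.card := by
  induction J using Finset.induction_on with
  | empty => exact h.isGorensteinAt_empty
  | insert l J hl ih =>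
    rw [Finset.card_insert_of_notMem hl]
    exact ih.insert hl

end IsQuantumAffine

/-! ### Grading, counting of monomials and growth -/

theorem LinearIndependent.iSupIndep_span_image_fiber {K V ι κ : Type*} [Field K]
    [AddCommGroup V] [Module K V] {v : ι → V} (hv : LinearIndependent K v) (f : ι → κ) :
    iSupIndep fun k => Submodule.span K (v '' {i | f i = k}) := by
  intro k
  have : (⨆ j, ⨆ (_ : j ≠ k), Submodule.span K (v '' {i | f i = j})) ≤
      Submodule.span K (v '' {i | f i ≠ k}) :=
    iSup₂_le fun j hj => Submodule.span_mono (Set.image_mono fun i (hi : f i = j) => by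
      simpa [hi] using hj)
  refine Disjoint.mono_right this (hv.disjoint_span_image ?_)
  exact Set.disjoint_left.2 fun i hi hi' => hi' hi

theorem finite_multiset_card_le (N k : ℕ) : {s : Multiset (Fin N) | s.card ≤ k}.Finite := by
  refine Set.Finite.of_finite_image (f := fun (s : Multiset (Fin N)) (i : Fin N) => s.count i)
    (Set.Finite.subset (Set.Finite.pi' fun _ : Fin N => Set.finite_Iic k) ?_) ?_
  · rintro _ ⟨s, hs, rfl⟩ i
    exact (Multiset.count_le_card i s).trans hs
  · intro s _ t _ hst
    exact Multiset.ext.2 fun i => congrFun hst i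

theorem ncard_multiset_card_le_le (N k : ℕ) :
    {s : Multiset (Fin N) | s.card ≤ k}.ncard ≤ (k + 1) ^ N := by
  have hcard : (Set.univ : Set (Fin N → Fin (k + 1))).ncard = (k + 1) ^ N := by
    rw [Set.ncard_univ, Nat.card_eq_fintype_card, Fintype.card_fun, Fintype.card_fin,
      Fintype.card_fin]
  rw [← hcard]
  refine Set.ncard_le_ncard_of_injOn
    (fun (s : Multiset (Fin N)) (i : Fin N) => Fin.ofNat (k + 1) (s.count i))
    (fun _ _ => Set.mem_univ _) (fun s hs t ht hst => Multiset.ext.2 fun i => ?_)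
  have := congrArg Fin.val (congrFun hst i)
  have hs' := (Multiset.count_le_card i s).trans hs
  have ht' := (Multiset.count_le_card i t).trans ht
  simpa [Nat.mod_eq_of_lt (Nat.lt_succ_of_le hs'), Nat.mod_eq_of_lt (Nat.lt_succ_of_le ht')]
    using this

/-- Multiplicities at most `k / N` may be chosen independently, since their sum stays at most `k`.
-/
theorem le_ncard_multiset_card_le (N k : ℕ) :
    (k / N + 1) ^ N ≤ {s : Multiset (Fin N) | s.card ≤ k}.ncard := by
  have hcard : (Set.univ : Set (Fin N → Fin (k / N + 1))).ncard = (k / N + 1) ^ N := by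
    rw [Set.ncard_univ, Nat.card_eq_fintype_card, Fintype.card_fun, Fintype.card_fin,
      Fintype.card_fin]
  rw [← hcard]
  refine Set.ncard_le_ncard_of_injOn
    (fun f : Fin N → Fin (k / N + 1) => ∑ i, Multiset.replicate (f i : ℕ) i)
    (fun f _ => ?_) (fun f _ g _ hfg => ?_) (finite_multiset_card_le N k)
  · change Multiset.card _ ≤ k
    rw [Multiset.card_sum]
    calc ∑ i, Multiset.card (Multiset.replicate (f i : ℕ) i) ≤ ∑ _i : Fin N, k / N :=
          Finset.sum_le_sum fun i _ => by
            rw [Multiset.card_replicate]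
            exact Nat.le_of_lt_succ (f i).2
      _ = N * (k / N) := by simp
      _ ≤ k := Nat.mul_div_le k N
  · funext i
    have := congrArg (Multiset.count i) hfg
    simp only [Multiset.count_sum', Multiset.count_replicate, Finset.sum_ite_eq',
      Finset.mem_univ, if_true] at this
    exact Fin.ext this

namespace IsQuantumAffine

variable {N : ℕ} {R : Type} [Ring R] [Algebra ℂ R] {p : Fin N → Fin N → ℂ} {x : Fin N → R}

theorem span_range_pow (h : IsQuantumAffine p x) (k : ℕ) :
    (Submodule.span ℂ (Set.range x)) ^ k =
      Submodule.span ℂ (monomialOf x '' {s | s.card = k}) := by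
  induction k with
  | zero =>
    rw [pow_zero, Submodule.one_eq_span]
    simp
  | succ k ih =>
    rw [pow_succ', ih, Submodule.span_mul_span]
    refine le_antisymm (Submodule.span_le.2 ?_) (Submodule.span_le.2 ?_)
    · rintro _ ⟨_, ⟨i, rfl⟩, _, ⟨s, hs, rfl⟩, rfl⟩
      obtain ⟨c, -, e⟩ := h.exists_mul_monomialOf i s
      simp only [e]
      exact Submodule.smul_mem _ _ (Submodule.subset_span
        ⟨i ::ₘ s, by simpa using hs, rfl⟩)
    · rintro _ ⟨s, hs, rfl⟩
      obtain ⟨i, t, rfl⟩ : ∃ i t, s = i ::ₘ t := by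
        obtain ⟨i, hi⟩ := Multiset.card_pos_iff_exists_mem.1 (by rw [hs]; omega)
        obtain ⟨t, ht⟩ := Multiset.exists_cons_of_mem hi
        exact ⟨i, t, ht⟩
      obtain ⟨c, hc, e⟩ := h.exists_mul_monomialOf i t
      rw [(eq_inv_smul_iff₀ hc).2 e.symm]
      exact Submodule.smul_mem _ _ (Submodule.subset_span
        ⟨x i, ⟨i, rfl⟩, _, ⟨t, by simpa using hs, rfl⟩, rfl⟩)

theorem isConnectedGraded (h : IsQuantumAffine p x) :
    IsConnectedGraded fun k => (Submodule.span ℂ (Set.range x)) ^ k where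
  gradedMonoid := Submodule.nat_power_gradedMonoid _
  isInternal := by
    simp only [h.span_range_pow]
    refine DirectSum.isInternal_submodule_of_iSupIndep_of_iSup_eq_top
      (h.linearIndependent_monomialOf.iSupIndep_span_image_fiber Multiset.card) ?_
    rw [eq_top_iff, ← h.span_monomialOf, Submodule.span_le]
    rintro _ ⟨s, rfl⟩
    exact Submodule.mem_iSup_of_mem s.card (Submodule.subset_span ⟨s, rfl, rfl⟩)
  finiteDimensional k := by
    rw [h.span_range_pow]
    exact FiniteDimensional.span_of_finite ℂ
      (((finite_multiset_card_le N k).subset fun s hs => le_of_eq hs).image _)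
  connected := by
    have : Nontrivial R := ⟨⟨monomialOf x 0, 0, h.linearIndependent_monomialOf.ne_zero 0⟩⟩
    rw [pow_zero, Submodule.one_eq_span]
    exact finrank_span_singleton one_ne_zero

theorem iSup_span_range_pow (h : IsQuantumAffine p x) (k : ℕ) :
    (⨆ l ≤ k, (Submodule.span ℂ (Set.range x)) ^ l) =
      Submodule.span ℂ (monomialOf x '' {s | s.card ≤ k}) := by
  simp only [h.span_range_pow]
  refine le_antisymm (iSup₂_le fun l hl => Submodule.span_mono (Set.image_mono
    fun s (hs : s.card = l) => hs.le.trans hl)) (Submodule.span_le.2 ?_)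
  rintro _ ⟨s, hs, rfl⟩
  exact Submodule.mem_iSup_of_mem s.card (Submodule.mem_iSup_of_mem hs
    (Submodule.subset_span ⟨s, rfl, rfl⟩))

theorem finiteDimensional_iSup_span_range_pow (h : IsQuantumAffine p x) (k : ℕ) :
    FiniteDimensional ℂ (⨆ l ≤ k, (Submodule.span ℂ (Set.range x)) ^ l : Submodule ℂ R) := by
  rw [h.iSup_span_range_pow]
  exact FiniteDimensional.span_of_finite ℂ ((finite_multiset_card_le N k).image _)

theorem finrank_iSup_span_range_pow (h : IsQuantumAffine p x) (k : ℕ) :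
    Module.finrank ℂ (⨆ l ≤ k, (Submodule.span ℂ (Set.range x)) ^ l : Submodule ℂ R) =
      {s : Multiset (Fin N) | s.card ≤ k}.ncard := by
  have := (finite_multiset_card_le N k).fintype
  rw [h.iSup_span_range_pow, Set.image_eq_range,
    finrank_span_eq_card (b := fun s : {s : Multiset (Fin N) | s.card ≤ k} => monomialOf x s)
      (h.linearIndependent_monomialOf.comp _ Subtype.val_injective),
    ← Nat.card_eq_fintype_card]
  rfl

/-- The dimension lies between `(k / N) ^ N` (real quotient) and `(k + 1) ^ N`. The constants `2 ^
N` and `N ^ N` are absorbed by an arbitrarily small positive power of `k`. -/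
theorem gkDim_eq (h : IsQuantumAffine p x) (hN : 0 < N) :
    gkDim (fun k => (Submodule.span ℂ (Set.range x)) ^ k) = (N : EReal) := by
  have hN' : (0 : ℝ) < N := Nat.cast_pos.2 hN
  refine le_antisymm (EReal.le_of_forall_lt_iff_le.1 fun z hz => ?_) (le_sInf ?_)
  · replace hz : (N : ℝ) < z := by exact_mod_cast hz
    refine sInf_le ⟨z, rfl, ?_⟩
    have ht : Tendsto (fun k : ℕ => (k : ℝ) ^ (z - N)) atTop atTop :=
      (tendsto_rpow_atTop (sub_pos.2 hz)).comp tendsto_natCast_atTop_atTop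
    filter_upwards [ht.eventually_ge_atTop (2 ^ N), eventually_ge_atTop 1] with k hk hk1
    refine ⟨h.finiteDimensional_iSup_span_range_pow k, ?_⟩
    rw [h.finrank_iSup_span_range_pow]
    have hk1' : (1 : ℝ) ≤ k := by exact_mod_cast hk1
    calc (({s : Multiset (Fin N) | s.card ≤ k}.ncard : ℕ) : ℝ) ≤ ((k : ℝ) + 1) ^ N := by
          exact_mod_cast ncard_multiset_card_le_le N k
      _ ≤ (2 * k) ^ N := by gcongr; linarith
      _ = 2 ^ N * (k : ℝ) ^ (N : ℝ) := by rw [mul_pow, Real.rpow_natCast]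
      _ ≤ (k : ℝ) ^ (z - N) * (k : ℝ) ^ (N : ℝ) := by gcongr
      _ = (k : ℝ) ^ z := by rw [← Real.rpow_add (by linarith), sub_add_cancel]
  · rintro _ ⟨α, rfl, hα⟩
    by_contra hlt
    replace hlt : α < N := by exact_mod_cast not_le.1 hlt
    have ht : Tendsto (fun k : ℕ => (k : ℝ) ^ (N - α)) atTop atTop :=
      (tendsto_rpow_atTop (sub_pos.2 hlt)).comp tendsto_natCast_atTop_atTop
    obtain ⟨k, ⟨-, hk⟩, hk', hk1⟩ :=
      (hα.and ((ht.eventually_gt_atTop ((N : ℝ) ^ N)).and (eventually_ge_atTop 1))).exists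
    rw [h.finrank_iSup_span_range_pow] at hk
    have hk1' : (1 : ℝ) ≤ k := by exact_mod_cast hk1
    have h1 : ((k : ℝ) / N) ^ N ≤ (k : ℝ) ^ α :=
      calc ((k : ℝ) / N) ^ N ≤ (((k / N : ℕ) : ℝ) + 1) ^ N := by
            gcongr
            rw [div_le_iff₀ hN']
            have := (Nat.lt_div_mul_add hN (a := k)).le
            have h2 : k ≤ (k / N + 1) * N := by rw [add_mul, one_mul]; exact this
            exact_mod_cast h2
        _ ≤ (({s : Multiset (Fin N) | s.card ≤ k}.ncard : ℕ) : ℝ) := by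
            exact_mod_cast le_ncard_multiset_card_le N k
        _ ≤ (k : ℝ) ^ α := hk
    rw [div_pow, div_le_iff₀ (by positivity)] at h1
    have h3 : (k : ℝ) ^ N = (k : ℝ) ^ α * (k : ℝ) ^ (N - α) := by
      rw [← Real.rpow_add (by linarith), add_sub_cancel, Real.rpow_natCast]
    rw [h3] at h1
    exact absurd (le_of_mul_le_mul_left h1 (by positivity)) (not_le.2 hk')

/-! ### The trivial module and regularity of quantum affine spaces -/

theorem mem_monomialSpan_univ (h : IsQuantumAffine p x) {k : ℕ} (hk : 1 ≤ k) {r : R}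
    (hr : r ∈ (Submodule.span ℂ (Set.range x)) ^ k) : r ∈ monomialSpan x Finset.univ := by
  rw [h.span_range_pow] at hr
  have hs : {s : Multiset (Fin N) | s.card = k} ⊆ {s | ∃ a ∈ s, a ∈ Finset.univ} := by
    intro s hs
    obtain ⟨a, ha⟩ := Multiset.card_pos_iff_exists_mem.1 (hk.trans_eq (Eq.symm hs))
    exact ⟨a, ha, Finset.mem_univ a⟩
  exact Submodule.span_mono (Set.image_mono hs) hr

theorem monomialOf_mem_iUnion (h : IsQuantumAffine p x) {s : Multiset (Fin N)} {a : Fin N}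
    (ha : a ∈ s) :
    monomialOf x s ∈ ⋃ k ∈ Set.Ici 1, (((Submodule.span ℂ (Set.range x)) ^ k : Submodule ℂ R) :
      Set R) := by
  refine Set.mem_biUnion (x := s.card) (Multiset.card_pos_iff_exists_mem.2 ⟨a, ha⟩) ?_
  rw [h.span_range_pow]
  exact Submodule.subset_span ⟨s, rfl, rfl⟩

theorem rightAugmentationIdeal_eq (h : IsQuantumAffine p x) :
    rightAugmentationIdeal (fun k => (Submodule.span ℂ (Set.range x)) ^ k) =
      h.rightIdeal Finset.univ := by
  refine le_antisymm (Submodule.span_le.2 ?_) fun r hr => ?_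
  · refine Set.iUnion₂_subset fun k hk r hr => h.mem_monomialSpan_univ hk hr
  · refine Submodule.span_induction ?_ (zero_mem _) (fun _ _ _ _ => add_mem)
      (fun c r _ hr => Submodule.smul_of_tower_mem _ c hr) (h.mem_rightIdeal.1 hr)
    rintro _ ⟨s, ⟨a, ha, -⟩, rfl⟩
    exact Submodule.subset_span (h.monomialOf_mem_iUnion ha)

theorem leftAugmentationIdeal_eq (h : IsQuantumAffine p x) :
    leftAugmentationIdeal (fun k => (Submodule.span ℂ (Set.range x)) ^ k) =
      h.leftIdeal Finset.univ := by
  refine le_antisymm (Submodule.span_le.2 ?_) fun r hr => ?_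
  · refine Set.iUnion₂_subset fun k hk r hr => h.mem_monomialSpan_univ hk hr
  · refine Submodule.span_induction ?_ (zero_mem _) (fun _ _ _ _ => add_mem)
      (fun c r _ hr => Submodule.smul_of_tower_mem _ c hr) (h.mem_leftIdeal.1 hr)
    rintro _ ⟨s, ⟨a, ha, -⟩, rfl⟩
    exact Submodule.subset_span (h.monomialOf_mem_iUnion ha)

theorem nontrivial_quotient_leftIdeal (h : IsQuantumAffine p x) (J : Finset (Fin N)) :
    Nontrivial (R ⧸ h.leftIdeal J) := by
  refine ⟨⟨Submodule.Quotient.mk 1, 0, fun h0 => ?_⟩⟩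
  rw [Submodule.Quotient.mk_eq_zero, h.mem_leftIdeal, h.mem_monomialSpan_iff] at h0
  have := h0 0 (by simp)
  rw [← monomialOf_zero x, ← h.basis_apply, Module.Basis.repr_self, Finsupp.single_eq_same] at this
  exact one_ne_zero this

/-- The upper bound is applied to the opposite algebra, whose modules are the right modules. The
trivial module attains it, because its `Ext^N` into `R` is nonzero. -/
theorem rightGlobalDimension_eq (h : IsQuantumAffine p x) :
    rightGlobalDimension R = (N : WithBot ℕ∞) := by
  refine le_antisymm (iSup_le fun M => ?_)
    (le_trans ?_ (le_iSup _ (h.quotModule Finset.univ)))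
  · exact (projectiveDimension_le_iff M N).2 (h.op.hasProjectiveDimensionLE M)
  · rw [projectiveDimension_ge_iff]
    intro hlt
    obtain ⟨Φ, -⟩ := (h.isGorensteinAt Finset.univ).exists_equiv
    have := h.nontrivial_quotient_leftIdeal Finset.univ
    have := HasProjectiveDimensionLT.subsingleton (h.quotModule Finset.univ) N
      (Finset.univ : Finset (Fin N)).card (by simp) (regularRightModule R)
    exact not_subsingleton _ Φ.symm.toEquiv.subsingleton

/-- A quantum affine space in `N ≥ 1` variables is Artin–Schelter regular of dimension `N`. -/
theorem isArtinSchelterRegular (h : IsQuantumAffine p x) (hN : 0 < N) :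
    IsArtinSchelterRegular (fun k => (Submodule.span ℂ (Set.range x)) ^ k) N where
  connectedGraded := h.isConnectedGraded
  globalDimension := h.rightGlobalDimension_eq
  gkDim_lt_top := by
    rw [h.gkDim_eq hN]
    exact EReal.coe_lt_top N
  ext_eq_zero k hk := by
    rw [trivialRightModule, h.rightAugmentationIdeal_eq]
    exact (h.isGorensteinAt Finset.univ).subsingleton k (by simpa using hk)
  ext_top := by
    rw [trivialRightModule, h.rightAugmentationIdeal_eq]
    have hG := h.isGorensteinAt Finset.univ
    rw [Finset.card_fin] at hG
    exact ⟨hG.exists_equiv.choose.trans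
      (Submodule.quotEquivOfEq _ _ h.leftAugmentationIdeal_eq.symm)⟩

end IsQuantumAffine

/-! ### The homogeneous coordinate algebra as a quantum affine space -/

/-- The commutation parameters of all generators of the homogeneous coordinate algebra. -/
noncomputable def homCoordParam {n : ℕ} (θ : Matrix (Fin n) (Fin n) ℂ) (i j : Fin (n + 1)) : ℂ :=
  Fin.lastCases (motive := fun _ => ℂ) 1
    (fun i' => Fin.lastCases (motive := fun _ => ℂ) 1 (fun j' => qParam θ i' j' ^ 2) j) i

section

variable {n : ℕ} (θ : Matrix (Fin n) (Fin n) ℂ)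

@[simp]
theorem homCoordParam_last_left (j : Fin (n + 1)) : homCoordParam θ (Fin.last n) j = 1 := by
  simp [homCoordParam]

@[simp]
theorem homCoordParam_last_right (i : Fin (n + 1)) : homCoordParam θ i (Fin.last n) = 1 := by
  induction i using Fin.lastCases <;> simp [homCoordParam]

@[simp]
theorem homCoordParam_castSucc (i j : Fin n) :
    homCoordParam θ i.castSucc j.castSucc = qParam θ i j ^ 2 := by
  simp [homCoordParam]

variable {θ}

theorem qParam_mul_swap (hθ : θ.transpose = -θ) (i j : Fin n) :
    qParam θ i j * qParam θ j i = 1 := by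
  have : θ j i = -θ i j := congrFun (congrFun hθ i) j
  rw [qParam, qParam, this, ← Complex.exp_add, ← Complex.exp_zero]
  congr 1
  ring

/-- This makes the relation with `i = j` vacuous; otherwise it could force `w_i ^ 2 = 0`. -/
theorem qParam_self (hθ : θ.transpose = -θ) (i : Fin n) : qParam θ i i = 1 := by
  have : θ i i = -θ i i := congrFun (congrFun hθ i) i
  rw [qParam, self_eq_neg.1 this, mul_zero, Complex.exp_zero]

/-- The homogeneous coordinate algebra is a quantum affine space. -/
theorem isQuantumAffine_homCoordGen (hθ : θ.transpose = -θ) :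
    IsQuantumAffine (homCoordParam θ) (homCoordGen θ) where
  param_mul i j := by
    induction i using Fin.lastCases <;> induction j using Fin.lastCases <;>
      simp [← mul_pow, qParam_mul_swap hθ]
  param_self i := by
    induction i using Fin.lastCases <;> simp [qParam_self hθ]
  comm i j := by
    have hl : ∀ i : Fin n, homCoordGen θ (Fin.last n) * homCoordGen θ i.castSucc =
        homCoordGen θ i.castSucc * homCoordGen θ (Fin.last n) := fun i => by
      simpa only [map_mul] using! RingQuot.mkAlgHom_rel ℂ (HomCoordRel.last_mul (θ := θ) i)
    induction i using Fin.lastCases with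
    | last =>
      induction j using Fin.lastCases with
      | last => simp
      | cast j => rw [homCoordParam_last_left, one_smul, hl]
    | cast i =>
      induction j using Fin.lastCases with
      | last => rw [homCoordParam_last_right, one_smul, hl]
      | cast j =>
        rw [homCoordParam_castSucc]
        simpa only [map_mul, map_smul] using!
          RingQuot.mkAlgHom_rel ℂ (HomCoordRel.mul_mul (θ := θ) i j)
  adjoin := by
    have hr : Set.range (homCoordGen θ) =
        RingQuot.mkAlgHom ℂ (HomCoordRel θ) '' Set.range (FreeAlgebra.ι ℂ) := by
      rw [← Set.range_comp]
      rfl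
    rw [hr, ← AlgHom.map_adjoin, FreeAlgebra.adjoin_range_ι, Algebra.map_top,
      AlgHom.range_eq_top]
    exact RingQuot.mkAlgHom_surjective ℂ _
  lift B _ _ y hy := by
    refine ⟨RingQuot.liftAlgHom ℂ ⟨FreeAlgebra.lift ℂ y, fun a b hab => ?_⟩, fun i => ?_⟩
    · cases hab with
      | last_mul i => simpa using hy (Fin.last n) i.castSucc
      | mul_mul i j => simpa using hy i.castSucc j.castSucc
    · rw [homCoordGen, RingQuot.liftAlgHom_mkAlgHom_apply, FreeAlgebra.lift_ι_apply]

end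

theorem mainTheorem5 (n : ℕ) (θ : Matrix (Fin n) (Fin n) ℂ) (hθ : θ.transpose = -θ) :
    IsArtinSchelterRegular (homCoordGrading θ) (n + 1) ∧
      gkDim (homCoordGrading θ) = ((n + 1 : ℕ) : EReal) :=
  ⟨(isQuantumAffine_homCoordGen hθ).isArtinSchelterRegular n.succ_pos,
    (isQuantumAffine_homCoordGen hθ).gkDim_eq n.succ_pos⟩
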